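/- Consider public-coin protocols in the shuffle model. A public random string $\alpha$ is sampled from a (discrete) distribution; each of the $n$ users applies the same randomizer $R_\alpha$, with independent private randomness, to their input $x_i$ and thereby produces a finite sequence of messages; all messages are concatenated and permuted uniformly at random; and an analyzer, given $\alpha$ and the shuffled messages, outputs a (random) real number. The protocol is *single-message* if every user always sends at most one message. It is *$(\epsilon,\delta)$-shuffle DP on $n$ users* if the map from datasets $(x_1,\dots,x_n)$ to the pair consisting of $\alpha$ and the shuffled messages is $(\epsilon,\delta)$-differentially private, where two datasets are neighboring if they differ, up to reordering, in one user's input. It *solves $\mathrm{CountDistinct}_{n,D}$ with error $e$* if, for every dataset of $n$ users with inputs from a universe of size $D$, its output is within $e$ of the number of distinct elements of the dataset with probability at least $0.99$. Theorem 4. For every function $\epsilon=\epsilon(n)\ge 0$ with $\epsilon = O(1)$ there are functions $\delta=\delta(n)\in(0,1]$ with $\delta = 2^{-\Theta(\log^8 n)}$ and $D = D(n)\in\mathbb{N}$ with $D=\Theta(n/\log^4 n)$ such that no public-coin single-message $(\epsilon,\delta)$-shuffle DP protocol on $n$ users solves $\mathrm{CountDistinct}_{n,D}$ with error $o(D)$.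 That is, for every function $e = e(n)$ with $e=o(D)$ and every sufficiently large $n$ (depending on $e$), there is no public-coin single-message $(\epsilon(n),\delta(n))$-shuffle DP protocol on $n$ users that solves $\mathrm{CountDistinct}_{n,D(n)}$ with error $e(n)$. -/

import Mathlib

open Filter Asymptotics

noncomputable section

/-- Two datasets of `n` users are neighboring if, up to reordering the users, they differ in the
input of (at most) one user. -/
def Neighboring {n : ℕ} {𝒳 : Type*} (X X' : Fin n → 𝒳) : Prop :=
  ∃ (σ : Equiv.Perm (Fin n)) (i : Fin n), ∀ j, j ≠ i → X' j = X (σ j)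

/-- `(ε, δ)`-differential privacy of a randomized algorithm on datasets of `n` users. -/
def IsDP {n : ℕ} {𝒳 𝒵 : Type*} (ε δ : ℝ) (P : (Fin n → 𝒳) → PMF 𝒵) : Prop :=
  ∀ X X' : Fin n → 𝒳, Neighboring X X' → ∀ S : Set 𝒵,
    (P X).toOuterMeasure S ≤
      ENNReal.ofReal (Real.exp ε) * (P X').toOuterMeasure S + ENNReal.ofReal δ

/-- The concatenation of the message sequences of users who independently apply the same local
randomizer `R` to their inputs. -/
def concatMessages {𝒳 Msg : Type*} (R : 𝒳 → PMF (List Msg)) : List 𝒳 → PMF (List Msg)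
  | [] => PMF.pure []
  | x :: xs => (R x).bind fun y => (concatMessages R xs).map fun ys => y ++ ys

/-- The shuffler: a uniformly random permutation of a sequence of messages. -/
def shuffler {Msg : Type*} (l : List Msg) : PMF (List Msg) :=
  (PMF.uniformOfFintype (Equiv.Perm (Fin l.length))).map fun σ =>
    List.ofFn fun i => l.get (σ i)

/-- A public-coin protocol in the shuffle model with inputs in `𝒳`, public random strings in `Coin`
and messages in `Msg`. All users apply the same local randomizer, which, like the analyzer,
sees the public random string. -/
structure ShuffleProtocol (Coin Msg 𝒳 : Type*) where
  /-- The distribution of the public random string. -/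
  pub : PMF Coin
  /-- The local randomizer. -/
  randomizer : Coin → 𝒳 → PMF (List Msg)
  /-- The (randomized) analyzer. -/
  analyzer : Coin → List Msg → PMF ℝ

namespace ShuffleProtocol

variable {Coin Msg 𝒳 : Type*}

/-- Every user always sends at most `k` messages. -/
def SendsAtMost (P : ShuffleProtocol Coin Msg 𝒳) (k : ℕ) : Prop :=
  ∀ a ∈ P.pub.support, ∀ x, ∀ l ∈ (P.randomizer a x).support, l.length ≤ k

/-- What the analyzer sees: the public random string and the shuffled messages. -/
def view (P : ShuffleProtocol Coin Msg 𝒳) {n : ℕ} (X : Fin n → 𝒳) : PMF (Coin × List Msg) :=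
  P.pub.bind fun a =>
    ((concatMessages (P.randomizer a) (List.ofFn X)).bind shuffler).map fun l => (a, l)

/-- The output of the protocol on a dataset. -/
def output (P : ShuffleProtocol Coin Msg 𝒳) {n : ℕ} (X : Fin n → 𝒳) : PMF ℝ :=
  (P.view X).bind fun v => P.analyzer v.1 v.2

/-- `P` is `(ε, δ)`-differentially private in the public-coin shuffle model with `n` users. -/
def IsShuffleDP (P : ShuffleProtocol Coin Msg 𝒳) (n : ℕ) (ε δ : ℝ) : Prop :=
  IsDP ε δ fun X : Fin n → 𝒳 => P.view X

end ShuffleProtocol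

/-- The number of distinct elements of a dataset. -/
def countDistinct {n D : ℕ} (X : Fin n → Fin D) : ℕ :=
  (Finset.univ.image X).card

/-- `P` solves the problem of counting distinct elements with `n` users and inputs from a universe
of size `D` with error `e`: on every dataset, the error is at most `e` with probability at least
`0.99`. -/
def ShuffleProtocol.SolvesCountDistinct {Coin Msg : Type*} {D : ℕ}
    (P : ShuffleProtocol Coin Msg (Fin D)) (n : ℕ) (e : ℝ) : Prop :=
  ∀ X : Fin n → Fin D,
    ENNReal.ofReal 0.99 ≤
      (P.output X).toOuterMeasure {z | |z - (countDistinct X : ℝ)| ≤ e}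

end

/-! The proof builds two random families of datasets with clearly different numbers of distinct
elements that no private single-message protocol can tell apart. With `κ` just above `log n`,
`exists_moment_matching` gives probability vectors `u`, `v` on the intensities `8 * i ^ 4`, `i ≤ κ`,
whose moments of order below `κ` agree, while `u` has mass at least `1/4` at `0` and `v` has none.
Draw an intensity for each element independently from `u` (or `v`); each user then independently
holds element `m` with probability intensity `/ n`, and otherwise the default element `x₀`. Under
`u` the mean number of distinct elements is at most `1 + 3D/4`; under `v` it is at least `(1 - exp
(-8)) D`.

Privacy enters through `toOuterMeasure_not_dominated_le`. As each user sends at most one message,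
the shuffled output reveals how many users produced an output in a set `E`. Comparing the constant
dataset `x₀` with a neighbor, the binomial law of this count forces `R x ≤ K * R x₀` up to mass `η`,
where `K` is of order `n / T`, provided `δ` is about `n ^ (-8T)`.

Given such domination, `sq_sum_mixture_le` handles one element at a time. The density of one user's
output is affine in the intensity, so the chi-squared expansion of the `n`-fold product involves
only moments of `u - v`, and those below `κ` vanish. The remaining terms are about `(768 * e * C * κ
^ 7 / T) ^ κ`, where `C` bounds `exp ε`; taking `T` a large multiple of `κ ^ 7` makes their square
root of order `n ^ (-2)`. Exchanging `u` for `v` in all `D ≤ n` coordinates costs `O(1 / n)`, even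
for an observer of the unshuffled messages (`abs_sum_dataWeight_mul_expect_sub_le`). With `T` of
order `log ^ 7 n`, `δ` is `2 ^ (-Θ(log ^ 8 n))`, and `D * 8κ ^ 4 ≤ n / 2` dictates `D = Θ(n / log ^
4 n)`. A Markov-type argument and a union bound reduce public coins to a fixed coin;
`not_solvesCountDistinct` combines everything. -/

/-! ### Product estimates behind the Lagrange weights. -/

theorem prod_Icc_sq_div_eq (i m : ℕ) (hm : m < i) :
    ∏ j ∈ Finset.Icc 1 m, ((j : ℝ) ^ 2 / |(j : ℝ) ^ 2 - (i : ℝ) ^ 2|) =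
      (m.factorial : ℝ) ^ 2 * (i - m - 1).factorial * i.factorial /
        ((i - 1).factorial * (i + m).factorial) := by
  induction m with
  | zero =>
    have h1 := (i - 1).factorial_pos
    have h2 := i.factorial_pos
    simp
    field_simp
  | succ m ih =>
    rw [Finset.prod_Icc_succ_top (by omega), ih (by omega)]
    obtain ⟨d, rfl⟩ : ∃ d, i = m + d + 2 := ⟨i - m - 2, by omega⟩
    have e1 : m + d + 2 - m - 1 = d + 1 := by omega
    have e2 : m + d + 2 - (m + 1) - 1 = d := by omega
    have e3 : m + d + 2 + (m + 1) = (m + d + 2 + m) + 1 := by omega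
    rw [e1, e2, e3, Nat.factorial_succ d, Nat.factorial_succ m,
      Nat.factorial_succ (m + d + 2 + m)]
    have habs : |((m + 1 : ℕ) : ℝ) ^ 2 - ((m + d + 2 : ℕ) : ℝ) ^ 2| =
        ((d : ℝ) + 1) * (m + d + 2 + m + 1) := by
      rw [abs_sub_comm, abs_of_nonneg]
      · push_cast; ring
      · push_cast; nlinarith [Nat.cast_nonneg (α := ℝ) m, Nat.cast_nonneg (α := ℝ) d]
    rw [habs]
    have h1 : ((m + d + 2 - 1).factorial : ℝ) ≠ 0 := by positivity
    have h2 : ((m + d + 2 + m).factorial : ℝ) ≠ 0 := by positivity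
    have h3 : ((d : ℝ) + 1) ≠ 0 := by positivity
    have h4 : ((m : ℝ) + d + 2 + m + 1) ≠ 0 := by positivity
    push_cast
    field_simp

theorem prod_erase_sq_div_eq (i κ : ℕ) (hi : 1 ≤ i) (hκ : i ≤ κ) :
    ∏ j ∈ (Finset.Icc 1 κ).erase i, ((j : ℝ) ^ 2 / |(j : ℝ) ^ 2 - (i : ℝ) ^ 2|) =
      2 * (κ.factorial : ℝ) ^ 2 / ((κ - i).factorial * (κ + i).factorial) := by
  induction κ, hκ using Nat.le_induction with
  | base =>
    obtain ⟨d, rfl⟩ : ∃ d, i = d + 1 := ⟨i - 1, by omega⟩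
    have : (Finset.Icc 1 (d + 1)).erase (d + 1) = Finset.Icc 1 d := by
      ext j; simp
    rw [this, prod_Icc_sq_div_eq _ _ (Nat.lt_succ_self d)]
    have e1 : d + 1 - d - 1 = 0 := by omega
    have e2 : d + 1 + (d + 1) = (d + 1 + d) + 1 := by omega
    rw [e1, e2, Nat.factorial_succ (d + 1 + d), Nat.factorial_succ d]
    have h1 : (d.factorial : ℝ) ≠ 0 := by positivity
    have h2 : ((d + 1 + d).factorial : ℝ) ≠ 0 := by positivity
    simp only [Nat.sub_self, Nat.factorial_zero]
    push_cast
    field_simp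
    ring
  | succ κ hκ ih =>
    have : (Finset.Icc 1 (κ + 1)).erase i = insert (κ + 1) ((Finset.Icc 1 κ).erase i) := by
      ext j; simp; omega
    rw [this, Finset.prod_insert (by simp), ih]
    obtain ⟨d, rfl⟩ : ∃ d, κ = i + d := ⟨κ - i, by omega⟩
    have e1 : i + d + 1 - i = d + 1 := by omega
    have e2 : i + d - i = d := by omega
    have e3 : i + d + 1 + i = (i + d + i) + 1 := by omega
    rw [e1, e2, e3, Nat.factorial_succ d, Nat.factorial_succ (i + d),
      Nat.factorial_succ (i + d + i)]
    have habs : |((i + d + 1 : ℕ) : ℝ) ^ 2 - (i : ℝ) ^ 2| =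
        ((d : ℝ) + 1) * (i + d + i + 1) := by
      rw [abs_of_nonneg]
      · push_cast; ring
      · push_cast; nlinarith [Nat.cast_nonneg (α := ℝ) i, Nat.cast_nonneg (α := ℝ) d]
    rw [habs]
    have h2 : ((i + d + i).factorial : ℝ) ≠ 0 := by positivity
    have h3 : ((d : ℝ) + 1) ≠ 0 := by positivity
    have h4 : ((i : ℝ) + d + i + 1) ≠ 0 := by positivity
    push_cast
    field_simp

theorem factorial_sq_le_factorial_mul (κ i : ℕ) (h : i ≤ κ) :
    κ.factorial ^ 2 ≤ (κ - i).factorial * (κ + i).factorial := by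
  have h1 := Nat.choose_le_centralBinom (κ + i) κ
  have h2 : (2 * κ).choose (κ + i) * ((κ - i).factorial * (κ + i).factorial) =
      (2 * κ).factorial := by
    have := Nat.choose_mul_factorial_mul_factorial (n := 2 * κ) (k := κ + i) (by omega)
    rw [show 2 * κ - (κ + i) = κ - i by omega] at this
    rw [← this]; ring
  have h3 : κ.centralBinom * κ.factorial ^ 2 = (2 * κ).factorial := by
    have := Nat.choose_mul_factorial_mul_factorial (n := 2 * κ) (k := κ) (by omega)
    rw [show 2 * κ - κ = κ by omega] at this
    rw [← this, Nat.centralBinom]; ring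
  have h4 := Nat.centralBinom_pos κ
  by_contra hlt
  push Not at hlt
  have : (2 * κ).choose (κ + i) * ((κ - i).factorial * (κ + i).factorial) <
      κ.centralBinom * κ.factorial ^ 2 :=
    lt_of_le_of_lt (Nat.mul_le_mul_right _ h1) (Nat.mul_lt_mul_of_pos_left hlt h4)
  omega

/-- Squares alone would only give the bound `2`, whose sum over `i` grows with `κ`. The extra factor
`j² / (j² + i²)`, at most `1/2` for `j < i`, supplies geometric decay in `i`; this is why the nodes
are fourth powers. -/
theorem prod_erase_pow_four_div_le (i κ : ℕ) (hi : 1 ≤ i) (hκ : i ≤ κ) :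
    ∏ j ∈ (Finset.Icc 1 κ).erase i, ((j : ℝ) ^ 4 / |(j : ℝ) ^ 4 - (i : ℝ) ^ 4|) ≤
      2 * (1 / 2) ^ (i - 1) := by
  have hi' : (0 : ℝ) < i := by exact_mod_cast hi
  have hfac : ∀ j ∈ (Finset.Icc 1 κ).erase i, ((j : ℝ) ^ 4 / |(j : ℝ) ^ 4 - (i : ℝ) ^ 4|) =
      ((j : ℝ) ^ 2 / |(j : ℝ) ^ 2 - (i : ℝ) ^ 2|) * ((j : ℝ) ^ 2 / ((j : ℝ) ^ 2 + (i : ℝ) ^ 2)) := by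
    intro j _
    have : (j : ℝ) ^ 4 - (i : ℝ) ^ 4 =
      ((j : ℝ) ^ 2 - (i : ℝ) ^ 2) * ((j : ℝ) ^ 2 + (i : ℝ) ^ 2) := by ring
    rw [this, abs_mul, abs_of_pos (a := (j : ℝ) ^ 2 + (i : ℝ) ^ 2) (by positivity),
      div_mul_div_comm]
    ring
  rw [Finset.prod_congr rfl hfac, Finset.prod_mul_distrib, prod_erase_sq_div_eq i κ hi hκ]
  refine mul_le_mul ?_ ?_ (Finset.prod_nonneg fun j _ => by positivity) (by norm_num)
  · rw [div_le_iff₀ (by positivity)]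
    have := factorial_sq_le_factorial_mul κ i hκ
    have : (κ.factorial : ℝ) ^ 2 ≤ (κ - i).factorial * (κ + i).factorial := by exact_mod_cast this
    linarith
  · calc ∏ j ∈ (Finset.Icc 1 κ).erase i, ((j : ℝ) ^ 2 / ((j : ℝ) ^ 2 + (i : ℝ) ^ 2))
        ≤ ∏ j ∈ (Finset.Icc 1 κ).erase i, (if j < i then (1 / 2 : ℝ) else 1) := by
          refine Finset.prod_le_prod (fun j _ => by positivity) fun j _ => ?_
          split_ifs with h
          · rw [div_le_div_iff₀ (by positivity) (by norm_num)]
            have : (j : ℝ) ^ 2 ≤ (i : ℝ) ^ 2 := by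
              have : (j : ℝ) ≤ i := by exact_mod_cast h.le
              gcongr
            linarith
          · rw [div_le_one (by positivity)]
            have : (0 : ℝ) ≤ (i : ℝ) ^ 2 := by positivity
            linarith
      _ = (1 / 2) ^ (i - 1) := by
          rw [Finset.prod_ite, Finset.prod_const, Finset.prod_const_one, mul_one]
          congr 1
          have : ((Finset.Icc 1 κ).erase i).filter (fun j => j < i) = Finset.Icc 1 (i - 1) := by
            ext j; simp; omega
          rw [this]; simp

/-! ### Moment-matching distributions. -/

/-- The nodes on which the moment-matching distributions live. -/
noncomputable def node (i : ℕ) : ℝ := 8 * (i : ℝ) ^ 4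

theorem node_injective : Function.Injective node := by
  intro i j h
  have : (i : ℝ) ^ 4 = (j : ℝ) ^ 4 := by unfold node at h; linarith
  exact_mod_cast (pow_left_inj₀ (Nat.cast_nonneg i) (Nat.cast_nonneg j) (by norm_num)).1 this

/-- Lagrange weights of the nodes `0, …, κ`, normalized to have weight `1` at `0`. -/
noncomputable def nodeWeight (κ i : ℕ) : ℝ :=
  (∏ j ∈ (Finset.range (κ + 1)).erase 0, (node 0 - node j)) /
    ∏ j ∈ (Finset.range (κ + 1)).erase i, (node i - node j)

/-- Up to a constant the weights are those of the `κ`-th divided difference, the coefficient of `X ^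
κ` in the interpolating polynomial, which is zero for `X ^ k` with `k < κ`. -/
theorem sum_nodeWeight_mul_pow (κ k : ℕ) (hk : k < κ) :
    ∑ i ∈ Finset.range (κ + 1), nodeWeight κ i * node i ^ k = 0 := by
  have h := Lagrange.coeff_eq_sum (s := Finset.range (κ + 1)) (v := node)
    node_injective.injOn (P := (Polynomial.X : Polynomial ℝ) ^ k)
    (by rw [Polynomial.degree_X_pow]; simp; exact_mod_cast (by omega : k < κ + 1))
  rw [Polynomial.coeff_X_pow, if_neg (by simp; omega)] at h
  have : ∀ i ∈ Finset.range (κ + 1), nodeWeight κ i * node i ^ k =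
      (∏ j ∈ (Finset.range (κ + 1)).erase 0, (node 0 - node j)) *
      (Polynomial.eval (node i) (Polynomial.X ^ k) /
        ∏ j ∈ (Finset.range (κ + 1)).erase i, (node i - node j)) := by
    intro i _
    rw [nodeWeight]; simp; ring
  rw [Finset.sum_congr rfl this, ← Finset.mul_sum, ← h, mul_zero]

theorem nodeWeight_zero (κ : ℕ) : nodeWeight κ 0 = 1 := by
  refine div_self (Finset.prod_ne_zero_iff.2 fun j hj => sub_ne_zero.2 fun h => ?_)
  exact (Finset.mem_erase.1 hj).1 (node_injective h).symm

theorem abs_nodeWeight_le (κ i : ℕ) (hi : 1 ≤ i) (hκ : i ≤ κ) :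
    |nodeWeight κ i| ≤ 2 * (1 / 2) ^ (i - 1) := by
  refine le_trans (le_of_eq ?_) (prod_erase_pow_four_div_le i κ hi hκ)
  -- The numerator's factor at `i` and the denominator's factor at `0` both have absolute value
  -- `node i` and cancel; so does the scale `8`.
  have e0 : (Finset.range (κ + 1)).erase 0 = insert i ((Finset.Icc 1 κ).erase i) := by
    ext j; simp; omega
  have ei : (Finset.range (κ + 1)).erase i = insert 0 ((Finset.Icc 1 κ).erase i) := by
    ext j; simp; omega
  have hn0 : node 0 = 0 := by simp [node]
  have hni : node i ≠ 0 := fun h => by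
    have := node_injective (h.trans hn0.symm); omega
  rw [nodeWeight, e0, ei, Finset.prod_insert (by simp), Finset.prod_insert (by simp), hn0,
    abs_div, abs_mul, abs_mul, zero_sub, sub_zero, abs_neg, mul_div_mul_left _ _ (abs_ne_zero.2 hni),
    Finset.abs_prod, Finset.abs_prod, ← Finset.prod_div_distrib]
  refine Finset.prod_congr rfl fun j _ => ?_
  rw [zero_sub, abs_neg, node, node, ← mul_sub, abs_mul, abs_mul, mul_div_mul_left _ _ (by norm_num),
    abs_of_nonneg (a := (j : ℝ) ^ 4) (by positivity), abs_sub_comm]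

/-- Two probability vectors on the nodes `0, 8 · 1 ^ 4, …, 8 · κ ^ 4` with the same moments of order
less than `κ`, one of which has a fixed amount of mass at `0` and the other none. -/
theorem exists_moment_matching (κ : ℕ) (hκ : 1 ≤ κ) :
    ∃ u v : Fin (κ + 1) → ℝ, (∀ i, 0 ≤ u i) ∧ (∀ i, 0 ≤ v i) ∧ ∑ i, u i = 1 ∧ ∑ i, v i = 1 ∧
      1 / 4 ≤ u 0 ∧ v 0 = 0 ∧ ∀ k < κ, ∑ i, (u i - v i) * node i ^ k = 0 := by
  set a : Fin (κ + 1) → ℝ := fun i => nodeWeight κ i with ha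
  have hmom : ∀ k < κ, ∑ i, a i * node i ^ k = 0 := fun k hk => by
    rw [← sum_nodeWeight_mul_pow κ k hk,
      ← Fin.sum_univ_eq_sum_range (fun i => nodeWeight κ i * node i ^ k)]
  have ha0 : a 0 = 1 := nodeWeight_zero κ
  have hsum : ∑ i, a i = 0 := by simpa using hmom 0 hκ
  -- The weights sum to zero, so their positive and negative parts have the same mass `Z`;
  -- normalized, these parts are `u` and `v`.
  set Z := ∑ i, max (a i) 0 with hZ
  have hZneg : ∑ i, max (-a i) 0 = Z := by
    have : ∑ i, (max (a i) 0 - max (-a i) 0) = 0 := by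
      refine (Finset.sum_congr rfl fun i _ => ?_).trans hsum
      rcases le_total 0 (a i) with h | h
      · rw [max_eq_left h, max_eq_right (by linarith)]; ring
      · rw [max_eq_right h, max_eq_left (by linarith)]; ring
    rw [Finset.sum_sub_distrib] at this
    linarith
  have hZ1 : 1 ≤ Z := by
    rw [hZ]
    calc (1 : ℝ) = max (a 0) 0 := by rw [ha0]; simp
      _ ≤ _ := Finset.single_le_sum (f := fun i => max (a i) 0) (fun i _ => le_max_right _ _)
        (Finset.mem_univ 0)
  -- The negative part misses the node `0`, so the geometric decay bounds its mass; this yields `u 0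
  -- = 1 / Z ≥ 1 / 4`.
  have hZ4 : Z ≤ 4 := by
    rw [← hZneg, Fin.sum_univ_succ, ha0]
    have h1 : ∀ i : Fin κ, max (-a i.succ) 0 ≤ 2 * (1 / 2) ^ (i : ℕ) := fun i => by
      refine max_le ?_ (by positivity)
      refine (neg_le_abs _).trans ?_
      have := abs_nodeWeight_le κ (i + 1) (by omega) (by omega)
      simpa [ha] using this
    have h2 : ∑ i : Fin κ, 2 * (1 / 2 : ℝ) ^ (i : ℕ) ≤ 4 := by
      rw [Fin.sum_univ_eq_sum_range (fun i => 2 * (1 / 2 : ℝ) ^ i), ← Finset.mul_sum]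
      have := geom_sum_eq (x := (1 / 2 : ℝ)) (by norm_num) κ
      have h3 : ((1 / 2 : ℝ) ^ κ - 1) / (1 / 2 - 1) = 2 * (1 - (1 / 2) ^ κ) := by ring
      rw [this, h3]
      have : (0 : ℝ) ≤ (1 / 2) ^ κ := by positivity
      linarith
    have := (Finset.sum_le_sum fun i (_ : i ∈ Finset.univ) => h1 i).trans h2
    norm_num at this ⊢
    linarith
  have hZ0 : 0 < Z := by linarith
  refine ⟨fun i => max (a i) 0 / Z, fun i => max (-a i) 0 / Z, 
    fun i => div_nonneg (le_max_right _ _) hZ0.le, fun i => div_nonneg (le_max_right _ _) hZ0.le,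
    ?_, ?_, ?_, ?_, fun k hk => ?_⟩
  · rw [← Finset.sum_div, ← hZ, div_self hZ0.ne']
  · rw [← Finset.sum_div, hZneg, div_self hZ0.ne']
  · simp only [ha0]
    rw [max_eq_left (by norm_num), div_le_div_iff₀ (by norm_num) hZ0]
    linarith
  · simp only [ha0]; norm_num
  · have : ∀ i ∈ Finset.univ, (max (a i) 0 / Z - max (-a i) 0 / Z) * node i ^ k =
        (a i * node i ^ k) / Z := fun i _ => by
      rcases le_total 0 (a i) with h | h
      · rw [max_eq_left h, max_eq_right (by linarith)]; ring
      · rw [max_eq_right h, max_eq_left (by linarith)]; ring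
    rw [Finset.sum_congr rfl this, ← Finset.sum_div, hmom k hk, zero_div]

/-! ### The chi-squared bound for mixtures of product densities. -/

/-- The sum factors over the coordinates, and in each factor the terms linear in `s` and `t` vanish
because `d` has total mass `0`. -/
theorem sum_prod_affine_mul_affine_div {β : Type*} [Fintype β] (n : ℕ) (b d : β → ℝ)
    (hb : ∀ y, 0 < b y) (hb1 : ∑ y, b y = 1) (hd : ∑ y, d y = 0) (s t : ℝ) :
    ∑ y : Fin n → β, (∏ j, (b (y j) + s * d (y j))) * (∏ j, (b (y j) + t * d (y j))) /
      ∏ j, b (y j) = (1 + s * t * ∑ y, d y ^ 2 / b y) ^ n := by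
  have h : 1 + s * t * ∑ y, d y ^ 2 / b y = ∑ y, (b y + s * d y) * (b y + t * d y) / b y := by
    have : ∀ y ∈ Finset.univ, (b y + s * d y) * (b y + t * d y) / b y =
        b y + (s + t) * d y + s * t * (d y ^ 2 / b y) := fun y _ => by
      have := (hb y).ne'
      field_simp
      ring
    rw [Finset.sum_congr rfl this, Finset.sum_add_distrib, Finset.sum_add_distrib, ← Finset.mul_sum,
      ← Finset.mul_sum, hb1, hd]
    ring
  rw [h, Fintype.sum_pow]
  refine Finset.sum_congr rfl fun y _ => ?_
  rw [Finset.prod_div_distrib, Finset.prod_mul_distrib]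

/-- The chi-squared bound: a signed mixture of product densities whose weights annihilate low
moments integrates every bounded test function to a small number. -/
theorem sq_sum_mixture_le {β I : Type*} [Fintype β] [Fintype I] (n κ : ℕ) (b d : β → ℝ)
    (hb : ∀ y, 0 < b y) (hb1 : ∑ y, b y = 1) (hd : ∑ y, d y = 0) (w α : I → ℝ) {A : ℝ} (hA : 0 ≤ A)
    (hα : ∀ i, |α i| ≤ A) (hw : ∑ i, |w i| ≤ 2)
    (hmom : ∀ k < κ, ∑ i, w i * α i ^ k = 0) (φ : (Fin n → β) → ℝ) (hφ : ∀ y, |φ y| ≤ 1) :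
    (∑ i, w i * ∑ y, (∏ j, (b (y j) + α i * d (y j))) * φ y) ^ 2 ≤
      ∑ k ∈ Finset.Ico κ (n + 1), 4 * (n.choose k * (A ^ 2 * ∑ y, d y ^ 2 / b y) ^ k) := by
  set s := ∑ y, d y ^ 2 / b y with hs
  have hs0 : 0 ≤ s := Finset.sum_nonneg fun y _ => div_nonneg (sq_nonneg _) (hb y).le
  set g : (Fin n → β) → ℝ := fun y => ∑ i, w i * ∏ j, (b (y j) + α i * d (y j)) with hg
  set B : (Fin n → β) → ℝ := fun y => ∏ j, b (y j) with hB
  have hB0 : ∀ y, 0 < B y := fun y => Finset.prod_pos fun j _ => hb _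
  have hB1 : ∑ y, B y = 1 := by rw [hB, ← Fintype.sum_pow, hb1, one_pow]
  have e1 : ∑ i, w i * ∑ y, (∏ j, (b (y j) + α i * d (y j))) * φ y = ∑ y, g y * φ y := by
    simp only [hg, Finset.mul_sum, Finset.sum_mul]
    rw [Finset.sum_comm]
    simp only [mul_assoc]
  -- Squaring `g` gives pairwise terms `(1 + α i * α i' * s) ^ n`; the binomial theorem separates
  -- `i` from `i'`, leaving squares of moments.
  have e2 : ∑ y, g y ^ 2 / B y =
      ∑ k ∈ Finset.range (n + 1), (n.choose k : ℝ) * s ^ k * (∑ i, w i * α i ^ k) ^ 2 := by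
    have h1 : ∑ y, g y ^ 2 / B y = ∑ i, ∑ i', w i * w i' * (1 + α i * α i' * s) ^ n := by
      have : ∀ i i', w i * w i' * (1 + α i * α i' * s) ^ n = ∑ y : Fin n → β, w i * w i' *
          ((∏ j, (b (y j) + α i * d (y j))) * (∏ j, (b (y j) + α i' * d (y j))) / B y) := by
        intro i i'
        rw [← Finset.mul_sum, sum_prod_affine_mul_affine_div n b d hb hb1 hd]
      simp only [this]
      have h2 : ∀ y, g y ^ 2 / B y = ∑ i, ∑ i', w i * w i' *
          ((∏ j, (b (y j) + α i * d (y j))) * (∏ j, (b (y j) + α i' * d (y j))) / B y) := by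
        intro y
        rw [hg, pow_two, Finset.sum_mul_sum, Finset.sum_div]
        refine Finset.sum_congr rfl fun i _ => ?_
        rw [Finset.sum_div]
        refine Finset.sum_congr rfl fun i' _ => ?_
        ring
      simp only [h2]
      rw [Finset.sum_comm]
      refine Finset.sum_congr rfl fun i _ => ?_
      rw [Finset.sum_comm]
    rw [h1]
    have h3 : ∀ i i', w i * w i' * (1 + α i * α i' * s) ^ n = ∑ k ∈ Finset.range (n + 1),
        (n.choose k : ℝ) * s ^ k * ((w i * α i ^ k) * (w i' * α i' ^ k)) := by
      intro i i'
      rw [add_comm, add_pow, Finset.mul_sum]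
      refine Finset.sum_congr rfl fun k _ => ?_
      rw [one_pow, mul_pow, mul_pow]
      ring
    simp only [h3]
    have h4 : ∀ k, (n.choose k : ℝ) * s ^ k * (∑ i, w i * α i ^ k) ^ 2 = ∑ i, ∑ i',
        (n.choose k : ℝ) * s ^ k * ((w i * α i ^ k) * (w i' * α i' ^ k)) := by
      intro k
      rw [pow_two (∑ i, w i * α i ^ k), Finset.sum_mul_sum, Finset.mul_sum]
      refine Finset.sum_congr rfl fun i _ => ?_
      rw [Finset.mul_sum]
    simp only [h4]
    rw [Finset.sum_comm]
    conv_lhs => rw [Finset.sum_comm]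
    rw [Finset.sum_comm (s := Finset.range (n + 1))]
    refine (Finset.sum_congr rfl fun i _ => ?_)
    rw [Finset.sum_comm]
  calc (∑ i, w i * ∑ y, (∏ j, (b (y j) + α i * d (y j))) * φ y) ^ 2
      = (∑ y, g y * φ y) ^ 2 := by rw [e1]
    -- Cauchy–Schwarz relative to the product density `B`.
    _ ≤ (∑ y, g y ^ 2 / B y) * ∑ y, B y * φ y ^ 2 := by
        refine Finset.sum_sq_le_sum_mul_sum_of_sq_le_mul _
          (fun y _ => div_nonneg (sq_nonneg _) (hB0 y).le)
          (fun y _ => mul_nonneg (hB0 y).le (sq_nonneg _)) fun y _ => ?_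
        have := (hB0 y).ne'
        refine le_of_eq ?_
        field_simp
    _ ≤ (∑ y, g y ^ 2 / B y) * 1 := by
        refine mul_le_mul_of_nonneg_left ?_
          (Finset.sum_nonneg fun y _ => div_nonneg (sq_nonneg _) (hB0 y).le)
        rw [← hB1]
        refine Finset.sum_le_sum fun y _ => ?_
        have : φ y ^ 2 ≤ 1 := (sq_le_one_iff_abs_le_one _).2 (hφ y)
        nlinarith [hB0 y]
    _ = ∑ k ∈ Finset.range (n + 1), (n.choose k : ℝ) * s ^ k * (∑ i, w i * α i ^ k) ^ 2 := by
        rw [mul_one, e2]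
    _ = ∑ k ∈ Finset.Ico κ (n + 1), (n.choose k : ℝ) * s ^ k * (∑ i, w i * α i ^ k) ^ 2 := by
        symm
        refine Finset.sum_subset (fun k hk => by simp at hk ⊢; omega) fun k _ hk' => ?_
        rw [hmom k (by simp at *; omega)]
        ring
    _ ≤ _ := by
        refine Finset.sum_le_sum fun k _ => ?_
        have h5 : |∑ i, w i * α i ^ k| ≤ 2 * A ^ k := by
          calc |∑ i, w i * α i ^ k| ≤ ∑ i, |w i * α i ^ k| := Finset.abs_sum_le_sum_abs _ _
              _ ≤ ∑ i, |w i| * A ^ k := by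
                  refine Finset.sum_le_sum fun i _ => ?_
                  rw [abs_mul, abs_pow]
                  exact mul_le_mul_of_nonneg_left (pow_le_pow_left₀ (abs_nonneg _) (hα i) k)
                    (abs_nonneg _)
              _ ≤ 2 * A ^ k := by
                  rw [← Finset.sum_mul]
                  exact mul_le_mul_of_nonneg_right hw (pow_nonneg hA k)
        have h6 : (∑ i, w i * α i ^ k) ^ 2 ≤ (2 * A ^ k) ^ 2 :=
          sq_le_sq' (by linarith [neg_abs_le (∑ i, w i * α i ^ k)]) ((le_abs_self _).trans h5)
        calc (n.choose k : ℝ) * s ^ k * (∑ i, w i * α i ^ k) ^ 2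
            ≤ (n.choose k : ℝ) * s ^ k * (2 * A ^ k) ^ 2 :=
              mul_le_mul_of_nonneg_left h6 (by positivity)
          _ = 4 * (n.choose k * (A ^ 2 * s) ^ k) := by ring

/-- Combines `n.choose k ≤ n ^ k / k!` with `k! ≥ (k / e) ^ k`. -/
theorem choose_mul_pow_le {n k : ℕ} (hk : 0 < k) {z : ℝ} (hz : 0 ≤ z) :
    n.choose k * z ^ k ≤ (Real.exp 1 * n * z / k) ^ k := by
  have hk' : (0 : ℝ) < k := by exact_mod_cast hk
  have h1 : (n.choose k : ℝ) ≤ (n : ℝ) ^ k / k.factorial := Nat.choose_le_pow_div k n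
  have h2 := Real.pow_div_factorial_le_exp (k : ℝ) hk'.le k
  have h3 : (1 : ℝ) / k.factorial ≤ Real.exp 1 ^ k / (k : ℝ) ^ k := by
    rw [← Real.exp_nat_mul, mul_one, div_le_div_iff₀ (by positivity) (by positivity), one_mul]
    rwa [div_le_iff₀ (by positivity)] at h2
  calc n.choose k * z ^ k ≤ (n : ℝ) ^ k / k.factorial * z ^ k := by gcongr
    _ = ((n : ℝ) ^ k * z ^ k) * (1 / k.factorial) := by ring
    _ ≤ ((n : ℝ) ^ k * z ^ k) * (Real.exp 1 ^ k / (k : ℝ) ^ k) := by gcongr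
    _ = _ := by rw [div_pow, mul_pow, mul_pow]; ring

/-- For every `k ≥ κ` the base in `choose_mul_pow_le` is at most `ρ`, so a geometric series of ratio
at most `1/2` dominates the tail. -/
theorem sum_choose_mul_pow_le {n κ : ℕ} (hκ : 0 < κ) {z ρ : ℝ} (hz : 0 ≤ z)
    (hρ : Real.exp 1 * n * z ≤ ρ * κ) (hρ2 : ρ ≤ 1 / 2) :
    ∑ k ∈ Finset.Ico κ (n + 1), 4 * (n.choose k * z ^ k) ≤ 8 * ρ ^ κ := by
  have hκ' : (0 : ℝ) < κ := by exact_mod_cast hκ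
  have hρ0 : 0 ≤ ρ := by
    have : 0 ≤ Real.exp 1 * n * z := by positivity
    by_contra h
    push Not at h
    nlinarith
  calc ∑ k ∈ Finset.Ico κ (n + 1), 4 * (n.choose k * z ^ k)
      ≤ ∑ k ∈ Finset.Ico κ (n + 1), 4 * ρ ^ k := by
        refine Finset.sum_le_sum fun k hk => ?_
        have hk' : κ ≤ k := (Finset.mem_Ico.1 hk).1
        have hk0 : (0 : ℝ) < k := by exact_mod_cast (lt_of_lt_of_le hκ hk')
        have h1 := choose_mul_pow_le (n := n) (lt_of_lt_of_le hκ hk') hz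
        have h2 : Real.exp 1 * n * z / k ≤ ρ := by
          rw [div_le_iff₀ hk0]
          have : (κ : ℝ) ≤ k := by exact_mod_cast hk'
          nlinarith
        have h3 := pow_le_pow_left₀ (by positivity) h2 k
        linarith
    _ = 4 * ρ ^ κ * ∑ j ∈ Finset.range (n + 1 - κ), ρ ^ j := by
        rw [Finset.sum_Ico_eq_sum_range, Finset.mul_sum]
        refine Finset.sum_congr rfl fun j _ => ?_
        rw [pow_add]; ring
    _ ≤ 4 * ρ ^ κ * 2 := by
        refine mul_le_mul_of_nonneg_left ?_ (by positivity)
        have h1 : (∑ j ∈ Finset.range (n + 1 - κ), ρ ^ j) * (1 - ρ) = 1 - ρ ^ (n + 1 - κ) :=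
          geom_sum_mul_neg ρ _
        have h2 : 0 ≤ ρ ^ (n + 1 - κ) := by positivity
        have h3 : 0 ≤ ∑ j ∈ Finset.range (n + 1 - κ), ρ ^ j :=
          Finset.sum_nonneg fun j _ => by positivity
        nlinarith
    _ = 8 * ρ ^ κ := by ring

/-! ### Hybrid argument over the elements. -/

theorem sum_fin_succ_arrow {I : Type*} [Fintype I] {D : ℕ} (f : (Fin (D + 1) → I) → ℝ) :
    ∑ l, f l = ∑ i, ∑ l : Fin D → I, f (Fin.cons i l) := by
  rw [← Fintype.sum_prod_type']
  exact (Fintype.sum_equiv (Fin.consEquiv fun _ => I) _ _ fun x => rfl).symm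

/-- Replacing the factors of a product distribution one at a time. -/
theorem abs_sum_prod_sub_sum_prod_le {I : Type*} [Fintype I] (u v : I → ℝ)
    (hu : ∀ i, 0 ≤ u i) (hv : ∀ i, 0 ≤ v i) (hu1 : ∑ i, u i = 1) (hv1 : ∑ i, v i = 1) (C : ℝ)
    (D : ℕ) (H : (Fin D → I) → ℝ)
    (h : ∀ m l, |∑ i, (u i - v i) * H (Function.update l m i)| ≤ C) :
    |∑ l : Fin D → I, (∏ m, u (l m)) * H l - ∑ l : Fin D → I, (∏ m, v (l m)) * H l| ≤ D * C := by
  induction D with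
  | zero => simp
  | succ D ih =>
    have e : ∀ w : I → ℝ, ∑ l : Fin (D + 1) → I, (∏ m, w (l m)) * H l =
        ∑ i, w i * ∑ l : Fin D → I, (∏ m, w (l m)) * H (Fin.cons i l) := by
      intro w
      rw [sum_fin_succ_arrow]
      refine Finset.sum_congr rfl fun i _ => ?_
      rw [Finset.mul_sum]
      refine Finset.sum_congr rfl fun l _ => ?_
      rw [Fin.prod_univ_succ]
      simp [mul_assoc]
    -- First exchange `u` for `v` in coordinate `0` with the others under `u`, then exchange the
    -- others with coordinate `0` under `v`.
    have hsplit : ∑ l : Fin (D + 1) → I, (∏ m, u (l m)) * H l -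
        ∑ l : Fin (D + 1) → I, (∏ m, v (l m)) * H l =
        ∑ l : Fin D → I, (∏ m, u (l m)) * ∑ i, (u i - v i) * H (Fin.cons i l) +
        ∑ i, v i * (∑ l : Fin D → I, (∏ m, u (l m)) * H (Fin.cons i l) -
          ∑ l : Fin D → I, (∏ m, v (l m)) * H (Fin.cons i l)) := by
      have e3 : ∑ l : Fin D → I, (∏ m, u (l m)) * ∑ i, (u i - v i) * H (Fin.cons i l) =
          ∑ i, (u i - v i) * ∑ l : Fin D → I, (∏ m, u (l m)) * H (Fin.cons i l) := by
        simp only [Finset.mul_sum]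
        rw [Finset.sum_comm]
        refine Finset.sum_congr rfl fun i _ => Finset.sum_congr rfl fun l _ => ?_
        ring
      rw [e, e, e3, ← Finset.sum_sub_distrib, ← Finset.sum_add_distrib]
      refine Finset.sum_congr rfl fun i _ => ?_
      ring
    rw [hsplit]
    have h1 : |∑ l : Fin D → I, (∏ m, u (l m)) * ∑ i, (u i - v i) * H (Fin.cons i l)| ≤ C := by
      have hone : ∑ l : Fin D → I, ∏ m, u (l m) = 1 := by rw [← Fintype.sum_pow, hu1, one_pow]
      calc _ ≤ ∑ l : Fin D → I, |(∏ m, u (l m)) * ∑ i, (u i - v i) * H (Fin.cons i l)| :=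
            Finset.abs_sum_le_sum_abs _ _
        _ ≤ ∑ l : Fin D → I, (∏ m, u (l m)) * C := by
            refine Finset.sum_le_sum fun l _ => ?_
            have hp : 0 ≤ ∏ m, u (l m) := Finset.prod_nonneg fun m _ => hu _
            rw [abs_mul, abs_of_nonneg hp]
            refine mul_le_mul_of_nonneg_left ?_ hp
            by_cases hI : Nonempty I
            · obtain ⟨i0⟩ := hI
              have := h 0 (Fin.cons i0 l)
              simpa only [Fin.update_cons_zero] using this
            · exfalso
              rw [not_nonempty_iff] at hI
              simp at hu1
        _ = C := by rw [← Finset.sum_mul, hone, one_mul]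
    have h2 : |∑ i, v i * (∑ l : Fin D → I, (∏ m, u (l m)) * H (Fin.cons i l) -
          ∑ l : Fin D → I, (∏ m, v (l m)) * H (Fin.cons i l))| ≤ D * C := by
      calc _ ≤ ∑ i, |v i * (∑ l : Fin D → I, (∏ m, u (l m)) * H (Fin.cons i l) -
          ∑ l : Fin D → I, (∏ m, v (l m)) * H (Fin.cons i l))| := Finset.abs_sum_le_sum_abs _ _
        _ ≤ ∑ i, v i * (D * C) := by
            refine Finset.sum_le_sum fun i _ => ?_
            rw [abs_mul, abs_of_nonneg (hv i)]
            refine mul_le_mul_of_nonneg_left (ih (fun l => H (Fin.cons i l)) fun m l => ?_) (hv i)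
            have := h m.succ (Fin.cons i l)
            simpa only [← Fin.cons_update] using this
        _ = D * C := by rw [← Finset.sum_mul, hv1, one_mul]
    push_cast
    linarith [abs_add_le (∑ l : Fin D → I, (∏ m, u (l m)) * ∑ i, (u i - v i) * H (Fin.cons i l))
      (∑ i, v i * (∑ l : Fin D → I, (∏ m, u (l m)) * H (Fin.cons i l) -
          ∑ l : Fin D → I, (∏ m, v (l m)) * H (Fin.cons i l)))]

/-! ### Indistinguishability under exact domination. -/

theorem node_nonneg (i : ℕ) : 0 ≤ node i := by unfold node; positivity

theorem node_mono {i j : ℕ} (h : i ≤ j) : node i ≤ node j := by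
  have : (i : ℝ) ≤ j := by exact_mod_cast h
  unfold node
  gcongr

/-- The density of a single message when each of `n` users independently holds the element `m` with
probability `node (l m) / n` and a default element otherwise. -/
noncomputable def mixDensity {β : Type*} {D κ : ℕ} (n : ℕ) (q : β → ℝ) (p : Fin D → β → ℝ)
    (l : Fin D → Fin (κ + 1)) (y : β) : ℝ :=
  q y + ∑ m, node (l m) / n * (p m y - q y)

/-- With all intensities but that of `m` frozen, the message density is `b + node i / n * d`, so
`sq_sum_mixture_le` applies with `α i = node i / n`; the hybrid argument pays this once per element.
-/
theorem abs_mixture_sub_mixture_le {β : Type*} [Fintype β] {D κ n : ℕ} (hn : 0 < n) (hκ : 0 < κ)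
    (hD : D * node κ ≤ n / 2) (q : β → ℝ) (p : Fin D → β → ℝ) (hq : ∀ y, 0 < q y)
    (hq1 : ∑ y, q y = 1) (hp : ∀ m y, 0 ≤ p m y) (hp1 : ∀ m, ∑ y, p m y = 1) {C : ℝ} (hC : 1 ≤ C)
    (hpq : ∀ m y, p m y ≤ C * q y) (u v : Fin (κ + 1) → ℝ)
    (hu : ∀ i, 0 ≤ u i) (hv : ∀ i, 0 ≤ v i) (hu1 : ∑ i, u i = 1) (hv1 : ∑ i, v i = 1)
    (hmom : ∀ k < κ, ∑ i, (u i - v i) * node i ^ k = 0) {ρ : ℝ}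
    (hρ : Real.exp 1 * (4 * C * node κ ^ 2 / n) ≤ ρ * κ) (hρ2 : ρ ≤ 1 / 2)
    (φ : (Fin n → β) → ℝ) (hφ : ∀ y, |φ y| ≤ 1) :
    |∑ l : Fin D → Fin (κ + 1), (∏ m, u (l m)) * ∑ y, (∏ j, mixDensity n q p l (y j)) * φ y -
      ∑ l : Fin D → Fin (κ + 1), (∏ m, v (l m)) * ∑ y, (∏ j, mixDensity n q p l (y j)) * φ y| ≤
      D * √(8 * ρ ^ κ) := by
  have hn' : (0 : ℝ) < n := by exact_mod_cast hn
  have hnode : ∀ i : Fin (κ + 1), node i ≤ node κ := fun i => node_mono (by omega)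
  refine abs_sum_prod_sub_sum_prod_le u v hu hv hu1 hv1 _ D
    (fun l => ∑ y, (∏ j, mixDensity n q p l (y j)) * φ y) fun m l => ?_
  set b : β → ℝ := fun y => q y + ∑ m' ∈ Finset.univ.erase m, node (l m') / n * (p m' y - q y)
    with hb
  set d : β → ℝ := fun y => p m y - q y with hd
  -- The worst case is `p m' y = 0` for every other element; the lost share of `q y` is then at most
  -- `D * node κ / n ≤ 1 / 2`.
  have hbq : ∀ y, q y / 2 ≤ b y := by
    intro y
    have h1 : -(D * (node κ / n * q y)) ≤
        ∑ m' ∈ Finset.univ.erase m, node (l m') / n * (p m' y - q y) := by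
      have h0 : 0 ≤ node κ / n * q y :=
        mul_nonneg (div_nonneg (node_nonneg _) hn'.le) (hq y).le
      have hcard : ((Finset.univ.erase m).card : ℝ) ≤ D := by
        exact_mod_cast (Finset.card_erase_le.trans (by simp) : (Finset.univ.erase m).card ≤ D)
      calc -(D * (node κ / n * q y)) ≤ ∑ m' ∈ Finset.univ.erase m, -(node κ / n * q y) := by
            rw [Finset.sum_const, nsmul_eq_mul]
            nlinarith
        _ ≤ _ := by
          refine Finset.sum_le_sum fun m' _ => ?_
          have h2 : node (l m') / n * q y ≤ node κ / n * q y :=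
            mul_le_mul_of_nonneg_right (div_le_div_of_nonneg_right (hnode _) hn'.le) (hq y).le
          have h3 : 0 ≤ node (l m') / n * p m' y :=
            mul_nonneg (div_nonneg (node_nonneg _) hn'.le) (hp _ _)
          linarith [mul_sub (node (l m') / n) (p m' y) (q y)]
    have h2 : D * (node κ / n * q y) ≤ q y / 2 := by
      calc D * (node κ / n * q y) = D * node κ * (q y / n) := by ring
        _ ≤ n / 2 * (q y / n) := mul_le_mul_of_nonneg_right hD (div_nonneg (hq y).le hn'.le)
        _ = q y / 2 := by field_simp
    simp only [hb]
    linarith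
  have hb0 : ∀ y, 0 < b y := fun y => lt_of_lt_of_le (half_pos (hq y)) (hbq y)
  have hd0 : ∑ y, d y = 0 := by rw [hd, Finset.sum_sub_distrib, hp1, hq1, sub_self]
  have hb1 : ∑ y, b y = 1 := by
    rw [hb, Finset.sum_add_distrib, hq1, Finset.sum_comm]
    simp only [← Finset.mul_sum, Finset.sum_sub_distrib, hp1, hq1]
    simp
  have hmix : ∀ i y, mixDensity n q p (Function.update l m i) y = b y + node i / n * d y := by
    intro i y
    rw [mixDensity, ← Finset.add_sum_erase _ _ (Finset.mem_univ m), Function.update_self]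
    have : ∀ m' ∈ Finset.univ.erase m, node (Function.update l m i m') / n * (p m' y - q y) =
        node (l m') / n * (p m' y - q y) := fun m' hm' => by
      rw [Function.update_of_ne (Finset.ne_of_mem_erase hm')]
    rw [Finset.sum_congr rfl this]
    simp only [hb, hd]
    ring
  have hs : ∑ y, d y ^ 2 / b y ≤ 4 * C := by
    have h1 : ∀ y, d y ^ 2 / b y ≤ 2 * C * (p m y + q y) := by
      intro y
      rw [div_le_iff₀ (hb0 y)]
      have h2 : |d y| ≤ C * q y := by
        rw [abs_le]
        constructor <;> simp only [hd] <;> nlinarith [hp m y, hpq m y, hq y]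
      have h3 : |d y| ≤ p m y + q y := by
        rw [abs_le]
        constructor <;> simp only [hd] <;> nlinarith [hp m y, hq y]
      have h4 : 0 ≤ p m y + q y := add_nonneg (hp m y) (hq y).le
      calc d y ^ 2 = |d y| * |d y| := by rw [← pow_two, sq_abs]
        _ ≤ (C * q y) * (p m y + q y) := mul_le_mul h2 h3 (abs_nonneg _) ((abs_nonneg _).trans h2)
        _ = 2 * C * (p m y + q y) * (q y / 2) := by ring
        _ ≤ _ := mul_le_mul_of_nonneg_left (hbq y) (by positivity)
    calc ∑ y, d y ^ 2 / b y ≤ ∑ y, 2 * C * (p m y + q y) := Finset.sum_le_sum fun y _ => h1 y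
      _ = 4 * C := by rw [← Finset.mul_sum, Finset.sum_add_distrib, hp1, hq1]; ring
  have hs0 : 0 ≤ ∑ y, d y ^ 2 / b y :=
    Finset.sum_nonneg fun y _ => div_nonneg (sq_nonneg _) (hb0 y).le
  have hchi := sq_sum_mixture_le n κ b d hb0 hb1 hd0 (fun i => u i - v i)
    (fun i : Fin (κ + 1) => node i / n) (A := node κ / n) (div_nonneg (node_nonneg _) hn'.le)
    (fun i => by
      rw [abs_of_nonneg (div_nonneg (node_nonneg _) hn'.le)]
      exact div_le_div_of_nonneg_right (hnode _) hn'.le)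
    (by
      calc ∑ i, |u i - v i| ≤ ∑ i, (u i + v i) := by
            refine Finset.sum_le_sum fun i _ => ?_
            rw [abs_le]
            constructor <;> linarith [hu i, hv i]
        _ = 2 := by rw [Finset.sum_add_distrib, hu1, hv1]; norm_num)
    (fun k hk => by
      simp only [div_pow, ← mul_div_assoc]
      rw [← Finset.sum_div, hmom k hk, zero_div]) φ hφ
  have hz : Real.exp 1 * n * ((node κ / n) ^ 2 * ∑ y, d y ^ 2 / b y) ≤ ρ * κ := by
    refine le_trans ?_ hρ
    calc Real.exp 1 * n * ((node κ / n) ^ 2 * ∑ y, d y ^ 2 / b y)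
        ≤ Real.exp 1 * n * ((node κ / n) ^ 2 * (4 * C)) := by gcongr
      _ = _ := by field_simp
  have hfin := hchi.trans (sum_choose_mul_pow_le hκ (mul_nonneg (sq_nonneg _) hs0) hz hρ2)
  simp only [hmix]
  exact Real.abs_le_sqrt hfin

/-! ### Expectations under discrete distributions. -/

open scoped ENNReal

namespace PMF

variable {α β : Type*}

/-- The expectation of a nonnegative function. -/
noncomputable def expect (P : PMF α) (f : α → ℝ≥0∞) : ℝ≥0∞ := ∑' x, P x * f x

theorem expect_bind (P : PMF α) (k : α → PMF β) (f : β → ℝ≥0∞) :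
    (P.bind k).expect f = P.expect fun x => (k x).expect f := by
  simp only [expect, bind_apply, ← ENNReal.tsum_mul_right, ← ENNReal.tsum_mul_left]
  rw [ENNReal.tsum_comm]
  simp only [mul_assoc]

theorem expect_pure (a : α) (f : α → ℝ≥0∞) : (PMF.pure a).expect f = f a := by
  rw [expect, tsum_eq_single a fun b hb => by simp [pure_apply, hb]]
  simp

theorem expect_map (P : PMF α) (g : α → β) (f : β → ℝ≥0∞) :
    (P.map g).expect f = P.expect fun x => f (g x) := by
  rw [map, expect_bind]
  simp [expect_pure]

theorem expect_mono (P : PMF α) {f g : α → ℝ≥0∞} (h : ∀ x, f x ≤ g x) :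
    P.expect f ≤ P.expect g :=
  ENNReal.tsum_le_tsum fun x => by gcongr; exact h x

theorem expect_congr (P : PMF α) {f g : α → ℝ≥0∞} (h : ∀ x ∈ P.support, f x = g x) :
    P.expect f = P.expect g := by
  refine tsum_congr fun x => ?_
  by_cases hx : x ∈ P.support
  · rw [h x hx]
  · rw [(P.apply_eq_zero_iff x).2 hx, zero_mul, zero_mul]

theorem expect_const (P : PMF α) (c : ℝ≥0∞) : (P.expect fun _ => c) = c := by
  rw [expect, ENNReal.tsum_mul_right, P.tsum_coe, one_mul]

theorem expect_add (P : PMF α) (f g : α → ℝ≥0∞) :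
    (P.expect fun x => f x + g x) = P.expect f + P.expect g := by
  simp only [expect, mul_add]
  exact ENNReal.tsum_add

theorem expect_mul_left (P : PMF α) (c : ℝ≥0∞) (f : α → ℝ≥0∞) :
    (P.expect fun x => c * f x) = c * P.expect f := by
  simp only [expect, ← ENNReal.tsum_mul_left]
  exact tsum_congr fun x => by ring

theorem expect_sum {ι : Type*} (s : Finset ι) (P : PMF α) (f : ι → α → ℝ≥0∞) :
    (P.expect fun x => ∑ i ∈ s, f i x) = ∑ i ∈ s, P.expect (f i) := by
  classical
  induction s using Finset.induction_on with
  | empty => simp [expect]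
  | insert i s hi ih => simp only [Finset.sum_insert hi, expect_add, ih]

theorem expect_le_one (P : PMF α) {f : α → ℝ≥0∞} (h : ∀ x, f x ≤ 1) : P.expect f ≤ 1 :=
  (P.expect_mono h).trans (P.expect_const 1).le

theorem toOuterMeasure_eq_expect (P : PMF α) (S : Set α) :
    P.toOuterMeasure S = P.expect (S.indicator 1) := by
  rw [toOuterMeasure_apply, expect]
  refine tsum_congr fun x => ?_
  by_cases hx : x ∈ S <;> simp [hx]

theorem toOuterMeasure_le_one (P : PMF α) (S : Set α) : P.toOuterMeasure S ≤ 1 := by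
  rw [toOuterMeasure_eq_expect]
  exact P.expect_le_one fun x => Set.indicator_le_self' (by simp) x

theorem toOuterMeasure_add_compl (P : PMF α) (S : Set α) :
    P.toOuterMeasure S + P.toOuterMeasure Sᶜ = 1 := by
  rw [toOuterMeasure_eq_expect, toOuterMeasure_eq_expect, ← expect_add]
  refine Eq.trans ?_ (P.expect_const 1)
  congr 1
  funext x
  by_cases hx : x ∈ S <;> simp [hx]

end PMF

/-! ### From privacy of the protocol to privacy for a fixed public string. -/

/-- The shuffled messages for a fixed public random string. -/
noncomputable def shuffledMessages {Msg 𝒳 : Type*} {n : ℕ} (R : 𝒳 → PMF (List Msg))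
    (X : Fin n → 𝒳) : PMF (List Msg) :=
  (concatMessages R (List.ofFn X)).bind shuffler

theorem ShuffleProtocol.toOuterMeasure_view {Coin Msg 𝒳 : Type*} (P : ShuffleProtocol Coin Msg 𝒳)
    {n : ℕ} (X : Fin n → 𝒳) (S : Set (Coin × List Msg)) :
    (P.view X).toOuterMeasure S = P.pub.expect fun a =>
      (shuffledMessages (P.randomizer a) X).toOuterMeasure {l | (a, l) ∈ S} := by
  simp only [PMF.toOuterMeasure_eq_expect, ShuffleProtocol.view, PMF.expect_bind, PMF.expect_map,
    shuffledMessages]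
  rfl

/-- Privacy for most fixed values of the public random string. -/
theorem ShuffleProtocol.toOuterMeasure_not_private_mul_le {Coin Msg 𝒳 : Type*}
    (P : ShuffleProtocol Coin Msg 𝒳) {n : ℕ} {ε δ : ℝ} (h : P.IsShuffleDP n ε δ)
    (X X' : Fin n → 𝒳) (hX : Neighboring X X') (δ' : ℝ≥0∞) :
    P.pub.toOuterMeasure {a | ∃ S, ENNReal.ofReal (Real.exp ε) *
      (shuffledMessages (P.randomizer a) X').toOuterMeasure S + δ' <
        (shuffledMessages (P.randomizer a) X).toOuterMeasure S} * δ' ≤ ENNReal.ofReal δ := by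
  classical
  set G : Set Coin := {a | ∃ S, ENNReal.ofReal (Real.exp ε) *
      (shuffledMessages (P.randomizer a) X').toOuterMeasure S + δ' <
        (shuffledMessages (P.randomizer a) X).toOuterMeasure S} with hG
  have hch : ∀ a, ∃ S : Set (List Msg), a ∈ G → ENNReal.ofReal (Real.exp ε) *
      (shuffledMessages (P.randomizer a) X').toOuterMeasure S + δ' <
        (shuffledMessages (P.randomizer a) X).toOuterMeasure S := fun a => by
    by_cases ha : a ∈ G
    · obtain ⟨S, hS⟩ := ha
      exact ⟨S, fun _ => hS⟩
    · exact ⟨∅, fun h => absurd h ha⟩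
  -- A violating event is chosen for each bad coin; since the view contains the coin, these glue to
  -- a single event `T` that gains `δ'` on every bad coin.
  choose S hS using hch
  set T : Set (Coin × List Msg) := {x | x.1 ∈ G ∧ x.2 ∈ S x.1} with hT
  have hDP := h X X' hX T
  have hlow : ENNReal.ofReal (Real.exp ε) * (P.view X').toOuterMeasure T +
      P.pub.toOuterMeasure G * δ' ≤ (P.view X).toOuterMeasure T := by
    rw [P.toOuterMeasure_view, P.toOuterMeasure_view, PMF.toOuterMeasure_eq_expect,
      ← PMF.expect_mul_left, mul_comm _ δ', ← PMF.expect_mul_left, ← PMF.expect_add]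
    refine PMF.expect_mono _ fun a => ?_
    by_cases ha : a ∈ G
    · have : {l | (a, l) ∈ T} = S a := by ext l; simp [hT, ha]
      rw [this]
      simpa [ha] using (hS a ha).le
    · have : {l | (a, l) ∈ T} = ∅ := by ext l; simp [hT, ha]
      simp [this, ha]
  have hle := hlow.trans hDP
  refine (ENNReal.add_le_add_iff_left ?_).1 hle
  exact ENNReal.mul_ne_top ENNReal.ofReal_ne_top
    (ne_top_of_le_ne_top ENNReal.one_ne_top (PMF.toOuterMeasure_le_one _ _))

theorem expect_shuffler_of_perm_invariant {Msg : Type*} (g : List Msg → ℝ≥0∞)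
    (hg : ∀ l l', l.Perm l' → g l = g l') (l : List Msg) : (shuffler l).expect g = g l := by
  rw [shuffler, PMF.expect_map]
  refine (PMF.expect_congr _ (g := fun _ => g l) fun σ _ => hg _ _ ?_).trans (PMF.expect_const _ _)
  have h := Equiv.Perm.ofFn_comp_perm σ l.get
  rw [List.ofFn_get] at h
  exact h

/-! ### Counting the users whose output lies in a given set. -/

open Classical in
/-- Given that each of `k` users sends at most one message, the number of users whose message
sequence lies in `E`. -/
noncomputable def countUsers {Msg : Type*} (E : Set (List Msg)) (k : ℕ) (l : List Msg) : ℕ :=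
  l.countP (fun m => [m] ∈ E) + if [] ∈ E then k - l.length else 0

theorem countUsers_perm {Msg : Type*} (E : Set (List Msg)) (k : ℕ) {l l' : List Msg}
    (h : l.Perm l') : countUsers E k l = countUsers E k l' := by
  rw [countUsers, countUsers, h.countP_eq, h.length_eq]

-- With at most one message per user, silent users are visible as the `k - length` missing messages,
-- so the shuffled list still determines the count. The length bounds keep the truncated subtraction
-- exact.
open Classical in
theorem countUsers_append {Msg : Type*} (E : Set (List Msg)) (k : ℕ) (y ys : List Msg)
    (hy : y.length ≤ 1) (hys : ys.length ≤ k) :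
    countUsers E (k + 1) (y ++ ys) = countUsers E k ys + if y ∈ E then 1 else 0 := by
  match y, hy with
  | [], _ =>
    simp only [countUsers, List.nil_append]
    split_ifs <;> omega
  | [m], _ =>
    simp only [countUsers, List.cons_append, List.nil_append, List.countP_cons, List.length_cons,
      decide_eq_true_eq]
    split_ifs <;> omega

theorem length_le_of_mem_support_concatMessages {Msg 𝒳 : Type*} {R : 𝒳 → PMF (List Msg)}
    (hR : ∀ x, ∀ l ∈ (R x).support, l.length ≤ 1) (xs : List 𝒳) :
    ∀ l ∈ (concatMessages R xs).support, l.length ≤ xs.length := by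
  induction xs with
  | nil => intro l hl; simp [concatMessages] at hl; simp [hl]
  | cons x xs ih =>
    intro l hl
    simp only [concatMessages, PMF.mem_support_bind_iff, PMF.mem_support_map_iff] at hl
    obtain ⟨y, hy, ys, hys, rfl⟩ := hl
    have h1 := hR x y hy
    have h2 := ih ys hys
    simp only [List.length_append, List.length_cons]
    omega

/-- The probability that exactly `t` users send a message sequence in `E`. -/
noncomputable def probCount {Msg 𝒳 : Type*} (R : 𝒳 → PMF (List Msg)) (E : Set (List Msg))
    (xs : List 𝒳) (t : ℕ) : ℝ≥0∞ :=
  (concatMessages R xs).toOuterMeasure {l | countUsers E xs.length l = t}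

/-- The count is invariant under permutations, so shuffling does not change its law. -/
theorem toOuterMeasure_shuffledMessages_countUsers {Msg 𝒳 : Type*} {n : ℕ}
    (R : 𝒳 → PMF (List Msg)) (E : Set (List Msg)) (X : Fin n → 𝒳) (t : ℕ) :
    (shuffledMessages R X).toOuterMeasure {l | countUsers E n l = t} =
      probCount R E (List.ofFn X) t := by
  rw [PMF.toOuterMeasure_eq_expect, shuffledMessages, PMF.expect_bind, probCount,
    PMF.toOuterMeasure_eq_expect, List.length_ofFn]
  congr 1
  funext l
  refine expect_shuffler_of_perm_invariant _ (fun l l' h => ?_) l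
  simp only [Set.indicator, Set.mem_ofPred_eq, countUsers_perm E n h, Pi.one_apply]

theorem expect_concatMessages_cons {Msg 𝒳 : Type*} (R : 𝒳 → PMF (List Msg)) (x : 𝒳) (xs : List 𝒳)
    (f : List Msg → ℝ≥0∞) : (concatMessages R (x :: xs)).expect f =
      (R x).expect fun y => (concatMessages R xs).expect fun ys => f (y ++ ys) := by
  simp only [concatMessages, PMF.expect_bind, PMF.expect_map]

theorem probCount_cons {Msg 𝒳 : Type*} {R : 𝒳 → PMF (List Msg)}
    (hR : ∀ x, ∀ l ∈ (R x).support, l.length ≤ 1) (E : Set (List Msg)) (x : 𝒳) (xs : List 𝒳)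
    (t : ℕ) : probCount R E (x :: xs) (t + 1) =
      (R x).toOuterMeasure E * probCount R E xs t +
        (R x).toOuterMeasure Eᶜ * probCount R E xs (t + 1) := by
  classical
  rw [probCount, PMF.toOuterMeasure_eq_expect, expect_concatMessages_cons,
    PMF.toOuterMeasure_eq_expect _ E, PMF.toOuterMeasure_eq_expect _ Eᶜ, mul_comm, ← PMF.expect_mul_left,
    mul_comm _ (probCount R E xs (t + 1)), ← PMF.expect_mul_left, ← PMF.expect_add]
  refine PMF.expect_congr _ fun y hy => ?_
  rw [probCount, probCount, PMF.toOuterMeasure_eq_expect, PMF.toOuterMeasure_eq_expect]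
  by_cases hyE : y ∈ E
  · simp only [hyE, Set.indicator_of_mem, Pi.one_apply, mul_one, Set.mem_compl_iff, not_true,
      not_false_eq_true, Set.indicator_of_notMem, mul_zero, add_zero]
    refine PMF.expect_congr _ fun ys hys => ?_
    have key := countUsers_append E _ y ys (hR x y hy)
      (length_le_of_mem_support_concatMessages hR xs ys hys)
    rw [if_pos hyE] at key
    simp [Set.indicator, key]
  · simp only [hyE, Set.indicator_of_mem, Pi.one_apply, mul_one, Set.mem_compl_iff,
      not_false_eq_true, Set.indicator_of_notMem, mul_zero, zero_add]
    refine PMF.expect_congr _ fun ys hys => ?_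
    have key := countUsers_append E _ y ys (hR x y hy)
      (length_le_of_mem_support_concatMessages hR xs ys hys)
    rw [if_neg hyE] at key
    simp [Set.indicator, key]

theorem probCount_cons_zero {Msg 𝒳 : Type*} {R : 𝒳 → PMF (List Msg)}
    (hR : ∀ x, ∀ l ∈ (R x).support, l.length ≤ 1) (E : Set (List Msg)) (x : 𝒳) (xs : List 𝒳) :
    probCount R E (x :: xs) 0 = (R x).toOuterMeasure Eᶜ * probCount R E xs 0 := by
  classical
  rw [probCount, PMF.toOuterMeasure_eq_expect, expect_concatMessages_cons,
    PMF.toOuterMeasure_eq_expect _ Eᶜ, mul_comm, ← PMF.expect_mul_left]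
  refine PMF.expect_congr _ fun y hy => ?_
  rw [probCount, PMF.toOuterMeasure_eq_expect]
  by_cases hyE : y ∈ E
  · simp only [hyE, Set.mem_compl_iff, not_true, not_false_eq_true, Set.indicator_of_notMem,
      mul_zero]
    refine Eq.trans (PMF.expect_congr _ fun ys hys => ?_) (PMF.expect_const _ 0)
    have key := countUsers_append E _ y ys (hR x y hy)
      (length_le_of_mem_support_concatMessages hR xs ys hys)
    rw [if_pos hyE] at key
    simp [Set.indicator, key]
  · simp only [hyE, Set.indicator_of_mem, Pi.one_apply, mul_one, Set.mem_compl_iff,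
      not_false_eq_true]
    refine PMF.expect_congr _ fun ys hys => ?_
    have key := countUsers_append E _ y ys (hR x y hy)
      (length_le_of_mem_support_concatMessages hR xs ys hys)
    rw [if_neg hyE] at key
    simp [Set.indicator, key]

theorem probCount_replicate {Msg 𝒳 : Type*} {R : 𝒳 → PMF (List Msg)}
    (hR : ∀ x, ∀ l ∈ (R x).support, l.length ≤ 1) (E : Set (List Msg)) (x : 𝒳) (m t : ℕ) :
    probCount R E (List.replicate m x) t =
      m.choose t * (R x).toOuterMeasure E ^ t * (R x).toOuterMeasure Eᶜ ^ (m - t) := by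
  induction m generalizing t with
  | zero =>
    rw [probCount, PMF.toOuterMeasure_eq_expect]
    simp only [List.replicate_zero, concatMessages, PMF.expect_pure]
    cases t <;> simp [countUsers]
  | succ m ih =>
    rw [List.replicate_succ]
    cases t with
    | zero =>
      rw [probCount_cons_zero hR, ih]
      simp [pow_succ, mul_comm]
    | succ t =>
      rw [probCount_cons hR, ih, ih, Nat.choose_succ_succ, Nat.add_sub_add_right]
      rcases Nat.lt_or_ge t m with h | h
      · rw [show m - t = m - (t + 1) + 1 by omega]
        push_cast
        ring
      · rw [Nat.choose_eq_zero_of_lt (show m < t + 1 by omega)]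
        push_cast
        ring

/-- Privacy applied to the event that exactly `t + 1` users land in `E`. Under `x₀` alone the count
is binomial. -/
theorem choose_mul_pow_mul_pow_le_of_private {Msg 𝒳 : Type*} {R : 𝒳 → PMF (List Msg)}
    (hR : ∀ x, ∀ l ∈ (R x).support, l.length ≤ 1) {ε δ : ℝ} (hδ : 0 ≤ δ) {m : ℕ} (x₀ x : 𝒳)
    (h : ∀ S, (shuffledMessages R (Fin.cons x fun _ : Fin m => x₀)).toOuterMeasure S ≤
      ENNReal.ofReal (Real.exp ε) *
        (shuffledMessages R (fun _ : Fin (m + 1) => x₀)).toOuterMeasure S + ENNReal.ofReal δ)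
    (E : Set (List Msg)) (t : ℕ) (p q : ℝ) (hp : (R x).toOuterMeasure E = ENNReal.ofReal p)
    (hq : (R x₀).toOuterMeasure E = ENNReal.ofReal q) (hp0 : 0 ≤ p) (hq0 : 0 ≤ q) (hq1 : q ≤ 1) :
    p * (m.choose t * q ^ t * (1 - q) ^ (m - t)) ≤
      Real.exp ε * ((m + 1).choose (t + 1) * q ^ (t + 1) * (1 - q) ^ (m - t)) + δ := by
  have hqc : (R x₀).toOuterMeasure Eᶜ = ENNReal.ofReal (1 - q) := by
    have := (R x₀).toOuterMeasure_add_compl E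
    rw [hq, show (1 : ℝ≥0∞) = ENNReal.ofReal q + ENNReal.ofReal (1 - q) by
      rw [← ENNReal.ofReal_add hq0 (by linarith)]; simp] at this
    exact (ENNReal.add_right_inj ENNReal.ofReal_ne_top).1 this
  have h1 := h {l | countUsers E (m + 1) l = t + 1}
  rw [toOuterMeasure_shuffledMessages_countUsers, toOuterMeasure_shuffledMessages_countUsers,
    List.ofFn_const, probCount_replicate hR, List.ofFn_cons, probCount_cons hR, List.ofFn_const,
    probCount_replicate hR, hp, hq, hqc, Nat.add_sub_add_right] at h1
  -- Drops the case where the replaced user falls outside `E`.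
  have h2 := le_self_add.trans h1
  have h1q : 0 ≤ 1 - q := by linarith
  rw [← ENNReal.ofReal_natCast, ← ENNReal.ofReal_natCast, ← ENNReal.ofReal_pow hq0,
    ← ENNReal.ofReal_pow h1q, ← ENNReal.ofReal_pow hq0, ← ENNReal.ofReal_mul (by positivity),
    ← ENNReal.ofReal_mul (by positivity), ← ENNReal.ofReal_mul (by positivity),
    ← ENNReal.ofReal_mul (by positivity), ← ENNReal.ofReal_mul (by positivity),
    ← ENNReal.ofReal_mul (by positivity), ← ENNReal.ofReal_add (by positivity) hδ,
    ENNReal.ofReal_le_ofReal_iff (by positivity)] at h2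
  exact h2

/-! ### Shuffle privacy implies domination of the randomizer. -/

theorem exp_neg_two_mul_le_one_sub {q : ℝ} (h0 : 0 ≤ q) (h : q ≤ 1 / 2) :
    Real.exp (-(2 * q)) ≤ 1 - q := by
  rw [Real.exp_neg]
  refine inv_le_of_inv_le₀ (by linarith) ?_
  refine le_trans ?_ (Real.add_one_le_exp (2 * q))
  rw [inv_le_comm₀ (by linarith) (by linarith), inv_le_iff_one_le_mul₀ (by linarith)]
  nlinarith

/-- If the number of users in a rare event is insensitive to replacing one `q`-user by a `p`-user,
then `p` cannot exceed `q` by a factor of the order of the number of users, unless it is tiny. -/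
theorem le_of_binomial_private {m T : ℕ} {C p q η δ : ℝ} (hT : 0 < T) (hTm : T ≤ m + 1)
    (hC : 1 ≤ C) (hp1 : p ≤ 1) (hq0 : 0 ≤ q) (hη0 : 0 < η) (hη1 : η ≤ 1)
    (h : ∀ t, p * (m.choose t * q ^ t * (1 - q) ^ (m - t)) ≤
      C * ((m + 1).choose (t + 1) * q ^ (t + 1) * (1 - q) ^ (m - t)) + δ)
    (hpq : 2 * C * (m + 1) / T * q ≤ p) (hδ : 4 * δ ≤ η)
    (hδT : 2 * δ ≤ η * (η / (4 * C * (m + 1) * Real.exp 1)) ^ T) : p ≤ η := by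
  have hm : (0 : ℝ) ≤ m := Nat.cast_nonneg m
  have hT' : (0 : ℝ) < T := by exact_mod_cast hT
  have hTm' : (T : ℝ) ≤ m + 1 := by exact_mod_cast hTm
  have hp0 : 0 ≤ p := le_trans (by positivity) hpq
  have hq2 : q ≤ T / (2 * (m + 1)) := by
    rw [le_div_iff₀ (by positivity)]
    rw [div_mul_eq_mul_div, div_le_iff₀ hT'] at hpq
    nlinarith [mul_nonneg hq0 (by positivity : (0 : ℝ) ≤ m + 1)]
  have hqh : q ≤ 1 / 2 := by
    refine hq2.trans ?_
    rw [div_le_div_iff₀ (by positivity) (by norm_num)]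
    linarith
  have h1q : 0 < 1 - q := by linarith
  -- If `q` is tiny, the test "exactly one user in `E`" suffices: by Bernoulli `(1 - q) ^ m ≥ 1 /
  -- 2`, and the right side is small.
  rcases le_or_gt (C * (m + 1) * q) (η / 4) with hcase | hcase
  · have h0 := h 0
    simp only [Nat.choose_zero_right, pow_zero, Nat.sub_zero, zero_add, Nat.choose_one_right,
      pow_one] at h0
    push_cast at h0
    have hB : 1 / 2 ≤ (1 - q) ^ m := by
      have := one_add_mul_le_pow (show (-2 : ℝ) ≤ -q by linarith) m
      rw [← sub_eq_add_neg] at this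
      nlinarith [mul_nonneg hq0 hm, mul_nonneg hq0 (by linarith : (0 : ℝ) ≤ C - 1),
        mul_nonneg (mul_nonneg hq0 hm) (by linarith : (0 : ℝ) ≤ C - 1)]
    nlinarith
  -- Otherwise test for exactly `T` users. The ratio `(m + 1) / T` of the binomial coefficients
  -- makes the privacy term at most `p * b / 2`, so `p * b ≤ 2 * δ`; the lower bound on `q` keeps
  -- `b` large enough to conclude.
  · obtain ⟨t, rfl⟩ : ∃ t, T = t + 1 := ⟨T - 1, by omega⟩
    set b : ℝ := m.choose t * q ^ t * (1 - q) ^ (m - t) with hb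
    have hqpos : η / (4 * C * (m + 1)) < q := by
      rw [div_lt_iff₀ (by positivity)]
      linarith
    have hq0' : 0 < q := lt_trans (by positivity) hqpos
    have hch : ((m + 1).choose (t + 1) : ℝ) = (m + 1) / ((t + 1 : ℕ) : ℝ) * m.choose t := by
      have := Nat.add_one_mul_choose_eq m t
      rw [div_mul_eq_mul_div, eq_div_iff hT'.ne']
      exact_mod_cast this.symm
    have h1 := h t
    have h2 : C * ((m + 1).choose (t + 1) * q ^ (t + 1) * (1 - q) ^ (m - t)) =
        (2 * C * (m + 1) / (t + 1 : ℕ) * q) / 2 * b := by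
      rw [hch, hb]; ring
    rw [h2] at h1
    have hb0 : 0 ≤ b := by positivity
    have h3 : p * b ≤ 2 * δ := by nlinarith
    have hbl : (η / (4 * C * (m + 1) * Real.exp 1)) ^ (t + 1) ≤ b := by
      have e1 : (η / (4 * C * (m + 1) * Real.exp 1)) ^ (t + 1) =
          (η / (4 * C * (m + 1))) ^ (t + 1) * Real.exp (-((t + 1 : ℕ) : ℝ)) := by
        rw [← div_div, div_pow _ (Real.exp 1), ← Real.exp_nat_mul, mul_one, Real.exp_neg]
        rfl
      have e2 : Real.exp (-((t + 1 : ℕ) : ℝ)) ≤ (1 - q) ^ (m - t) := by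
        calc Real.exp (-((t + 1 : ℕ) : ℝ)) ≤ Real.exp (((m + 1 : ℕ) : ℝ) * (-(2 * q))) := by
              rw [Real.exp_le_exp]
              rw [le_div_iff₀ (by positivity)] at hq2
              push_cast at hq2 ⊢
              linarith
          _ = Real.exp (-(2 * q)) ^ (m + 1) := Real.exp_nat_mul _ _
          _ ≤ (1 - q) ^ (m + 1) :=
              pow_le_pow_left₀ (Real.exp_pos _).le (exp_neg_two_mul_le_one_sub hq0 hqh) _
          _ ≤ (1 - q) ^ (m - t) := pow_le_pow_of_le_one h1q.le (by linarith) (by omega)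
      have e3 : (η / (4 * C * (m + 1))) ^ (t + 1) ≤ q ^ t := by
        calc (η / (4 * C * (m + 1))) ^ (t + 1) ≤ q ^ (t + 1) :=
              pow_le_pow_left₀ (by positivity) hqpos.le _
          _ ≤ q ^ t := pow_le_pow_of_le_one hq0 (by linarith) (by omega)
      have e4 : (1 : ℝ) ≤ m.choose t := by
        exact_mod_cast Nat.choose_pos (by omega : t ≤ m)
      rw [e1, hb]
      refine mul_le_mul (e3.trans ?_) e2 (Real.exp_pos _).le (by positivity)
      exact le_mul_of_one_le_left (by positivity) e4
    have hbpos : 0 < b := lt_of_lt_of_le (by positivity) hbl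
    by_contra hlt
    push Not at hlt
    nlinarith

/-- Shuffle privacy forces every randomizer output distribution to be dominated, up to a tiny
mass, by a multiple of the output distribution of a default input. -/
theorem toOuterMeasure_not_dominated_le {Msg 𝒳 : Type*} {R : 𝒳 → PMF (List Msg)}
    (hR : ∀ x, ∀ l ∈ (R x).support, l.length ≤ 1) {ε C η δ : ℝ} {m T : ℕ} (hδ0 : 0 ≤ δ)
    (hεC : Real.exp ε ≤ C) (hT : 0 < T) (hTm : T ≤ m + 1)
    (hC : 1 ≤ C) (hη0 : 0 < η) (hη1 : η ≤ 1) (hδ : 4 * δ ≤ η)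
    (hδT : 2 * δ ≤ η * (η / (4 * C * (m + 1) * Real.exp 1)) ^ T) (x₀ x : 𝒳)
    (h : ∀ S, (shuffledMessages R (Fin.cons x fun _ : Fin m => x₀)).toOuterMeasure S ≤
      ENNReal.ofReal (Real.exp ε) *
        (shuffledMessages R (fun _ : Fin (m + 1) => x₀)).toOuterMeasure S + ENNReal.ofReal δ) :
    (R x).toOuterMeasure {y | ¬ R x y ≤ ENNReal.ofReal (2 * C * (m + 1) / T) * R x₀ y} ≤
      ENNReal.ofReal η := by
  set E := {y | ¬ R x y ≤ ENNReal.ofReal (2 * C * (m + 1) / T) * R x₀ y} with hE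
  have hle := fun z => (R z).toOuterMeasure_le_one E
  have htop := fun z => ne_top_of_le_ne_top ENNReal.one_ne_top (hle z)
  have hp := (ENNReal.ofReal_toReal (htop x)).symm
  have hq := (ENNReal.ofReal_toReal (htop x₀)).symm
  set p := ((R x).toOuterMeasure E).toReal
  set q := ((R x₀).toOuterMeasure E).toReal
  have hp0 : 0 ≤ p := ENNReal.toReal_nonneg
  have hq0 : 0 ≤ q := ENNReal.toReal_nonneg
  have hp1 : p ≤ 1 := ENNReal.toReal_le_of_le_ofReal (by norm_num) (by simpa using hle x)
  have hq1 : q ≤ 1 := ENNReal.toReal_le_of_le_ofReal (by norm_num) (by simpa using hle x₀)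
  have hK0 : 0 ≤ 2 * C * (m + 1) / T := by positivity
  rw [hp]
  refine ENNReal.ofReal_le_ofReal ?_
  refine le_of_binomial_private hT hTm hC hp1 hq0 hη0 hη1 (fun t => ?_) ?_ hδ hδT
  · refine (choose_mul_pow_mul_pow_le_of_private hR hδ0 x₀ x h E t p q hp hq hp0 hq0 hq1).trans ?_
    have : 0 ≤ 1 - q := by linarith
    gcongr
  · rw [← ENNReal.ofReal_le_ofReal_iff hp0, ENNReal.ofReal_mul hK0, ← hp, ← hq,
      PMF.toOuterMeasure_apply, PMF.toOuterMeasure_apply, ← ENNReal.tsum_mul_left]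
    refine ENNReal.tsum_le_tsum fun y => ?_
    by_cases hy : y ∈ E
    · simp only [hy, Set.indicator_of_mem]
      exact (not_le.1 hy).le
    · simp [hy]

/-! ### Finite approximation of the message distributions. -/

theorem sum_prod_mul_le_expect_concatMessages {Msg 𝒳 : Type*} (R : 𝒳 → PMF (List Msg))
    (F : Finset (List Msg)) (s : 𝒳 → F → ℝ≥0∞) (hs : ∀ x y, s x y ≤ R x y) {n : ℕ}
    (X : Fin n → 𝒳) (g : List Msg → ℝ≥0∞) :
    ∑ y : Fin n → F, (∏ j, s (X j) (y j)) * g (List.ofFn fun j => (y j : List Msg)).flatten ≤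
      (concatMessages R (List.ofFn X)).expect g := by
  induction n generalizing g with
  | zero => simp [concatMessages, PMF.expect_pure]
  | succ n ih =>
    have e : ∑ y : Fin (n + 1) → F, (∏ j, s (X j) (y j)) *
        g (List.ofFn fun j => (y j : List Msg)).flatten = ∑ z : F, s (X 0) z *
        ∑ y : Fin n → F, (∏ j, s (X j.succ) (y j)) *
          g (z ++ (List.ofFn fun j => (y j : List Msg)).flatten) := by
      rw [← Equiv.sum_comp (Fin.consEquiv fun _ => F), Fintype.sum_prod_type]
      refine Finset.sum_congr rfl fun z _ => ?_
      rw [Finset.mul_sum]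
      refine Finset.sum_congr rfl fun y _ => ?_
      simp [Fin.consEquiv, Fin.prod_univ_succ, List.ofFn_succ, mul_assoc]
    rw [e, List.ofFn_succ, expect_concatMessages_cons]
    calc _ ≤ ∑ z : F, R (X 0) z * (concatMessages R (List.ofFn fun j => X j.succ)).expect
          fun ys => g (z ++ ys) := by
          refine Finset.sum_le_sum fun z _ => ?_
          exact mul_le_mul' (hs _ _) (ih (fun j => X j.succ) fun ys => g (z ++ ys))
      _ = ∑ z ∈ F, R (X 0) z * (concatMessages R (List.ofFn fun j => X j.succ)).expect
          fun ys => g (z ++ ys) := Finset.sum_coe_sort F (fun z => R (X 0) z *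
            (concatMessages R (List.ofFn fun j => X j.succ)).expect fun ys => g (z ++ ys))
      _ ≤ _ := ENNReal.sum_le_tsum F

theorem sum_prod_eq_prod_sum {ι κ : Type*} [Fintype ι] [DecidableEq ι] [Fintype κ] (f : ι → κ → ℝ) :
    ∑ y : ι → κ, ∏ j, f j (y j) = ∏ j, ∑ z, f j z := by
  rw [Finset.prod_univ_sum, Fintype.piFinset_univ]

/-- Replacing each of `n` factors by a finitely supported approximation. -/
theorem abs_toReal_expect_sub_sum_le {Msg 𝒳 : Type*} (R : 𝒳 → PMF (List Msg))
    (F : Finset (List Msg)) (s p : 𝒳 → F → ℝ) (hs0 : ∀ x y, 0 ≤ s x y)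
    (hs : ∀ x y, ENNReal.ofReal (s x y) ≤ R x y) (hsp : ∀ x y, s x y ≤ p x y)
    (hp1 : ∀ x, ∑ y, p x y = 1) {τ : ℝ} (hτ : τ ≤ 1) (hsτ : ∀ x, 1 - τ ≤ ∑ y, s x y)
    {n : ℕ} (X : Fin n → 𝒳) (g : List Msg → ℝ≥0∞) (hg : ∀ l, g l ≤ 1) :
    |((concatMessages R (List.ofFn X)).expect g).toReal -
      ∑ y : Fin n → F, (∏ j, p (X j) (y j)) *
        (g (List.ofFn fun j => (y j : List Msg)).flatten).toReal| ≤ n * τ := by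
  have hlow : ∀ f : List Msg → ℝ≥0∞, (∀ l, f l ≤ 1) →
      ∑ y : Fin n → F, (∏ j, s (X j) (y j)) *
        (f (List.ofFn fun j => (y j : List Msg)).flatten).toReal ≤
      ((concatMessages R (List.ofFn X)).expect f).toReal := by
    intro f hf
    have h1 := sum_prod_mul_le_expect_concatMessages R F (fun x y => ENNReal.ofReal (s x y)) hs X f
    have htop : (concatMessages R (List.ofFn X)).expect f ≠ ⊤ :=
      ne_top_of_le_ne_top ENNReal.one_ne_top (PMF.expect_le_one _ hf)
    rw [← ENNReal.ofReal_le_iff_le_toReal htop]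
    refine le_trans (le_of_eq ?_) h1
    rw [ENNReal.ofReal_sum_of_nonneg fun y _ =>
      mul_nonneg (Finset.prod_nonneg fun j _ => hs0 _ _) ENNReal.toReal_nonneg]
    refine Finset.sum_congr rfl fun y _ => ?_
    rw [ENNReal.ofReal_mul (Finset.prod_nonneg fun j _ => hs0 _ _),
      ENNReal.ofReal_prod_of_nonneg fun j _ => hs0 _ _,
      ENNReal.ofReal_toReal (ne_top_of_le_ne_top ENNReal.one_ne_top (hf _))]
  set φ : (Fin n → F) → ℝ := fun y => (g (List.ofFn fun j => (y j : List Msg)).flatten).toReal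
    with hφ
  have hφ0 : ∀ y, 0 ≤ φ y := fun y => ENNReal.toReal_nonneg
  have hφ1 : ∀ y, φ y ≤ 1 := fun y =>
    ENNReal.toReal_le_of_le_ofReal (by norm_num) (by simpa using hg _)
  have h1 := hlow g hg
  -- Applying the lower bound to `1 - g` as well supplies the upper bound for `g`.
  have h2 := hlow (fun l => 1 - g l) fun l => tsub_le_self
  have hcompl : ((concatMessages R (List.ofFn X)).expect fun l => 1 - g l).toReal =
      1 - ((concatMessages R (List.ofFn X)).expect g).toReal := by
    have h3 := PMF.expect_add (concatMessages R (List.ofFn X)) g (fun l => 1 - g l)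
    have h4 : (fun l => g l + (1 - g l)) = fun _ => (1 : ℝ≥0∞) :=
      funext fun l => add_tsub_cancel_of_le (hg l)
    rw [h4, PMF.expect_const] at h3
    have h5 := congrArg ENNReal.toReal h3
    rw [ENNReal.toReal_add (ne_top_of_le_ne_top ENNReal.one_ne_top (PMF.expect_le_one _ hg))
      (ne_top_of_le_ne_top ENNReal.one_ne_top (PMF.expect_le_one _ fun l => tsub_le_self)),
      ENNReal.toReal_one] at h5
    linarith
  have hsub : ∀ y : Fin n → F, (1 - g (List.ofFn fun j => (y j : List Msg)).flatten).toReal =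
      1 - φ y := fun y => by
    rw [ENNReal.toReal_sub_of_le (hg _) ENNReal.one_ne_top, ENNReal.toReal_one]
  simp only [hsub, mul_sub, mul_one, Finset.sum_sub_distrib] at h2
  rw [hcompl] at h2
  have hprod : ∀ r : 𝒳 → F → ℝ, ∑ y : Fin n → F, ∏ j, r (X j) (y j) = ∏ j, ∑ z, r (X j) z :=
    fun r => sum_prod_eq_prod_sum fun j z => r (X j) z
  -- By Bernoulli, at most `n * τ` of the joint mass is lost.
  have hS : 1 - n * τ ≤ ∑ y : Fin n → F, ∏ j, s (X j) (y j) := by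
    rw [hprod]
    calc 1 - n * τ = 1 + n * -τ := by ring
      _ ≤ (1 + -τ) ^ n := one_add_mul_le_pow (by linarith) n
      _ = ∏ _j : Fin n, (1 - τ) := by simp [sub_eq_add_neg]
      _ ≤ _ := Finset.prod_le_prod (fun j _ => by linarith) fun j _ => hsτ _
  have hP : ∑ y : Fin n → F, ∏ j, p (X j) (y j) = 1 := by
    rw [hprod]
    exact Finset.prod_eq_one fun j _ => hp1 _
  have h3 : ∑ y : Fin n → F, (∏ j, s (X j) (y j)) * φ y ≤
      ∑ y : Fin n → F, (∏ j, p (X j) (y j)) * φ y :=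
    Finset.sum_le_sum fun y _ => mul_le_mul_of_nonneg_right
      (Finset.prod_le_prod (fun j _ => hs0 _ _) fun j _ => hsp _ _) (hφ0 y)
  have h4 : ∑ y : Fin n → F, (∏ j, s (X j) (y j)) * (1 - φ y) ≤
      ∑ y : Fin n → F, (∏ j, p (X j) (y j)) * (1 - φ y) :=
    Finset.sum_le_sum fun y _ => mul_le_mul_of_nonneg_right
      (Finset.prod_le_prod (fun j _ => hs0 _ _) fun j _ => hsp _ _) (by linarith [hφ1 y])
  simp only [mul_sub, mul_one, Finset.sum_sub_distrib] at h4
  rw [abs_le]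
  constructor <;> linarith

/-! ### The random datasets and their messages. -/

/-- The probability that a user holds `x` when every element `m` is held with probability
`node (l m) / n` and the remaining probability goes to `x₀`. -/
noncomputable def inputProb {D κ : ℕ} (n : ℕ) (x₀ : Fin D) (l : Fin D → Fin (κ + 1)) (x : Fin D) :
    ℝ :=
  node (l x) / n + if x = x₀ then 1 - ∑ m, node (l m) / n else 0

/-- The probability of a dataset `X` whose entries are independent with distribution
`inputProb n x₀ l`, where the entries of `l` are independent with distribution `u`. -/
noncomputable def dataWeight {D κ n : ℕ} (x₀ : Fin D) (u : Fin (κ + 1) → ℝ) (X : Fin n → Fin D) :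
    ℝ :=
  ∑ l : Fin D → Fin (κ + 1), (∏ m, u (l m)) * ∏ j, inputProb n x₀ l (X j)

theorem sum_node_div_le {D κ n : ℕ} (hn : 0 < n) (hD : D * node κ ≤ n / 2)
    (l : Fin D → Fin (κ + 1)) : ∑ m, node (l m) / n ≤ 1 / 2 := by
  have hn' : (0 : ℝ) < n := by exact_mod_cast hn
  calc ∑ m, node (l m) / n ≤ ∑ _m : Fin D, node κ / n :=
        Finset.sum_le_sum fun m _ => div_le_div_of_nonneg_right (node_mono (by omega)) hn'.le
    _ = D * node κ / n := by simp [mul_div_assoc]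
    _ ≤ 1 / 2 := by rw [div_le_iff₀ hn']; linarith

theorem inputProb_nonneg {D κ n : ℕ} (hn : 0 < n) (hD : D * node κ ≤ n / 2) (x₀ : Fin D)
    (l : Fin D → Fin (κ + 1)) (x : Fin D) : 0 ≤ inputProb n x₀ l x := by
  have := sum_node_div_le hn hD l
  have := node_nonneg (l x)
  rw [inputProb]
  split_ifs
  · have : 0 ≤ 1 - ∑ m, node (l m) / n := by linarith
    positivity
  · positivity

theorem sum_inputProb_mul {D κ : ℕ} (n : ℕ) (x₀ : Fin D) (l : Fin D → Fin (κ + 1))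
    (f : Fin D → ℝ) :
    ∑ x, inputProb n x₀ l x * f x = f x₀ + ∑ m, node (l m) / n * (f m - f x₀) := by
  simp only [inputProb, add_mul, Finset.sum_add_distrib, mul_sub, Finset.sum_sub_distrib, ite_mul,
    zero_mul, Finset.sum_ite_eq', Finset.mem_univ, if_true, ← Finset.sum_mul]
  ring

theorem sum_inputProb {D κ : ℕ} (n : ℕ) (x₀ : Fin D) (l : Fin D → Fin (κ + 1)) :
    ∑ x, inputProb n x₀ l x = 1 := by
  simpa using sum_inputProb_mul n x₀ l fun _ => 1

theorem dataWeight_nonneg {D κ n : ℕ} (hn : 0 < n) (hD : D * node κ ≤ n / 2) (x₀ : Fin D)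
    {u : Fin (κ + 1) → ℝ} (hu : ∀ i, 0 ≤ u i) (X : Fin n → Fin D) : 0 ≤ dataWeight x₀ u X :=
  Finset.sum_nonneg fun l _ => mul_nonneg (Finset.prod_nonneg fun _ _ => hu _)
    (Finset.prod_nonneg fun _ _ => inputProb_nonneg hn hD x₀ l _)

theorem sum_dataWeight_mul {D κ n : ℕ} (x₀ : Fin D) (u : Fin (κ + 1) → ℝ)
    (G : (Fin n → Fin D) → ℝ) : ∑ X, dataWeight x₀ u X * G X =
      ∑ l : Fin D → Fin (κ + 1), (∏ m, u (l m)) * ∑ X, (∏ j, inputProb n x₀ l (X j)) * G X := by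
  simp only [dataWeight, Finset.sum_mul, Finset.mul_sum]
  rw [Finset.sum_comm]
  simp only [mul_assoc]

theorem sum_prod_weight {D κ : ℕ} {u : Fin (κ + 1) → ℝ} (hu1 : ∑ i, u i = 1) :
    ∑ l : Fin D → Fin (κ + 1), ∏ m, u (l m) = 1 := by
  rw [← Fintype.sum_pow, hu1, one_pow]

theorem sum_dataWeight {D κ n : ℕ} (x₀ : Fin D) {u : Fin (κ + 1) → ℝ} (hu1 : ∑ i, u i = 1) :
    ∑ X : Fin n → Fin D, dataWeight x₀ u X = 1 := by
  have := sum_dataWeight_mul (n := n) x₀ u fun _ => 1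
  simp only [mul_one] at this
  rw [this]
  simp only [← Fintype.sum_pow, sum_inputProb, one_pow, mul_one, hu1]

/-- Given the intensities the users are independent, so summing out their inputs leaves a product of
copies of `mixDensity`, the form treated by `abs_mixture_sub_mixture_le`. -/
theorem sum_dataWeight_mul_sum_prod {β : Type*} [Fintype β] {D κ n : ℕ} (x₀ : Fin D)
    (u : Fin (κ + 1) → ℝ) (p : Fin D → β → ℝ) (φ : (Fin n → β) → ℝ) :
    ∑ X : Fin n → Fin D, dataWeight x₀ u X * ∑ y, (∏ j, p (X j) (y j)) * φ y =
      ∑ l : Fin D → Fin (κ + 1), (∏ m, u (l m)) *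
        ∑ y, (∏ j, mixDensity n (p x₀) p l (y j)) * φ y := by
  rw [sum_dataWeight_mul]
  refine Finset.sum_congr rfl fun l _ => ?_
  congr 1
  simp only [Finset.mul_sum]
  rw [Finset.sum_comm]
  refine Finset.sum_congr rfl fun y _ => ?_
  simp only [← mul_assoc, ← Finset.sum_mul, ← Finset.prod_mul_distrib]
  rw [sum_prod_eq_prod_sum fun j x => inputProb n x₀ l x * p x (y j)]
  congr 1
  refine Finset.prod_congr rfl fun j _ => ?_
  rw [sum_inputProb_mul, mixDensity]

/-- A probability distribution concentrates, up to `η`, on a finite subset of its support. -/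
theorem PMF.exists_finset_toOuterMeasure_compl_le {α : Type*} (q : PMF α) {η : ℝ} (hη : 0 < η) :
    ∃ F : Finset α, (∀ y ∈ F, q y ≠ 0) ∧
      q.toOuterMeasure (F : Set α)ᶜ ≤ ENNReal.ofReal η := by
  classical
  rcases le_or_gt 1 η with h1 | h1
  · exact ⟨∅, by simp, (q.toOuterMeasure_le_one _).trans (by simpa using h1)⟩
  have hlt : ENNReal.ofReal (1 - η) < ∑' y, q y := by
    rw [q.tsum_coe, ENNReal.ofReal_lt_one]
    linarith
  rw [ENNReal.tsum_eq_iSup_sum, lt_iSup_iff] at hlt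
  obtain ⟨F, hF⟩ := hlt
  refine ⟨F.filter fun y => q y ≠ 0, fun y hy => (Finset.mem_filter.1 hy).2, ?_⟩
  set F' := F.filter fun y => q y ≠ 0
  have hsum : ∑ y ∈ F', q y = ∑ y ∈ F, q y := Finset.sum_filter_ne_zero F
  have h2 := q.toOuterMeasure_add_compl (F' : Set α)
  rw [q.toOuterMeasure_apply_finset, hsum] at h2
  have h3 : ENNReal.ofReal (1 - η) + q.toOuterMeasure (F' : Set α)ᶜ ≤
      ENNReal.ofReal (1 - η) + ENNReal.ofReal η := by
    rw [← ENNReal.ofReal_add (by linarith) hη.le]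
    simp only [sub_add_cancel, ENNReal.ofReal_one]
    rw [← h2]
    gcongr
  exact (ENNReal.add_le_add_iff_left ENNReal.ofReal_ne_top).1 h3

/-- When all output distributions of the randomizer are essentially dominated by that of `x₀`, no
analyzer can tell apart the datasets generated from two moment-matching distributions. -/
theorem abs_sum_dataWeight_mul_expect_sub_le {Msg : Type*} {D κ n : ℕ}
    (R : Fin D → PMF (List Msg)) (x₀ : Fin D) {K η : ℝ} (hK : 1 ≤ K) (hη0 : 0 < η)
    (hη : η ≤ 1 / 4)
    (hdom : ∀ x, (R x).toOuterMeasure {y | ¬ R x y ≤ ENNReal.ofReal K * R x₀ y} ≤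
      ENNReal.ofReal η)
    (hn : 0 < n) (hκ : 0 < κ) (hD : D * node κ ≤ n / 2) (u v : Fin (κ + 1) → ℝ)
    (hu : ∀ i, 0 ≤ u i) (hv : ∀ i, 0 ≤ v i) (hu1 : ∑ i, u i = 1) (hv1 : ∑ i, v i = 1)
    (hmom : ∀ k < κ, ∑ i, (u i - v i) * node i ^ k = 0) {ρ : ℝ}
    (hρ : Real.exp 1 * (4 * (K + 1) * node κ ^ 2 / n) ≤ ρ * κ) (hρ2 : ρ ≤ 1 / 2)
    (g : List Msg → ℝ≥0∞) (hg : ∀ l, g l ≤ 1) :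
    |∑ X : Fin n → Fin D, dataWeight x₀ u X *
        ((concatMessages R (List.ofFn X)).expect g).toReal -
      ∑ X : Fin n → Fin D, dataWeight x₀ v X *
        ((concatMessages R (List.ofFn X)).expect g).toReal| ≤
      D * √(8 * ρ ^ κ) + 2 * (n * (2 * η)) := by
  classical
  have hK0 : 0 < K := by linarith
  -- Mass `η / K` of `R x₀` outside `F` becomes at most `η` of the dominated part of `R x`; with the
  -- undominated mass, `s` loses at most `2 * η`.
  obtain ⟨F, hFpos, hF⟩ := (R x₀).exists_finset_toOuterMeasure_compl_le (div_pos hη0 hK0)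
  set s : Fin D → F → ℝ := fun x y =>
    if R x y ≤ ENNReal.ofReal K * R x₀ y then (R x y).toReal else 0 with hs
  have htop : ∀ x (y : List Msg), R x y ≠ ⊤ := fun x y => (R x).apply_ne_top y
  have hs0 : ∀ x y, 0 ≤ s x y := fun x y => by
    simp only [hs]; split_ifs <;> simp
  have hsR : ∀ x y, ENNReal.ofReal (s x y) ≤ R x y := fun x y => by
    simp only [hs]
    split_ifs
    · rw [ENNReal.ofReal_toReal (htop _ _)]
    · simp
  have hsK : ∀ x y, s x y ≤ K * (R x₀ y).toReal := fun x y => by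
    simp only [hs]
    split_ifs with h
    · have := ENNReal.toReal_mono (ENNReal.mul_ne_top ENNReal.ofReal_ne_top (htop _ _)) h
      rwa [ENNReal.toReal_mul, ENNReal.toReal_ofReal hK0.le] at this
    · exact mul_nonneg hK0.le ENNReal.toReal_nonneg
  have hsx₀ : ∀ y, s x₀ y = (R x₀ y).toReal := fun y => by
    simp only [hs]
    rw [if_pos]
    exact le_mul_of_one_le_left' (by simpa using hK)
  have hσ1 : ∀ x, ∑ y, s x y ≤ 1 := fun x => by
    have h1 : ENNReal.ofReal (∑ y, s x y) ≤ 1 := by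
      rw [ENNReal.ofReal_sum_of_nonneg fun y _ => hs0 x y]
      calc _ ≤ ∑ y : F, R x y := Finset.sum_le_sum fun y _ => hsR x y
        _ = ∑ y ∈ F, R x y := Finset.sum_coe_sort F fun y => R x y
        _ ≤ _ := ENNReal.sum_le_tsum F
        _ = 1 := (R x).tsum_coe
    simpa using h1
  have hσ : ∀ x, 1 - 2 * η ≤ ∑ y, s x y := fun x => by
    have hpt : ∀ y, R x y ≤ (if h : y ∈ F then ENNReal.ofReal (s x ⟨y, h⟩) else 0) +
        ({y | ¬ R x y ≤ ENNReal.ofReal K * R x₀ y}.indicator (R x) y +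
          ENNReal.ofReal K * (F : Set (List Msg))ᶜ.indicator (R x₀) y) := by
      intro y
      by_cases hgood : R x y ≤ ENNReal.ofReal K * R x₀ y
      · by_cases hy : y ∈ F
        · simp only [hy, dif_pos, hs, hgood, if_true]
          rw [ENNReal.ofReal_toReal (htop _ _)]
          exact le_self_add
        · simp [hy, hgood]
      · simp only [Set.indicator, Set.mem_ofPred_eq, hgood, not_false_eq_true, if_true]
        exact le_add_left le_self_add
    have h1 := ENNReal.tsum_le_tsum hpt
    rw [ENNReal.tsum_add, ENNReal.tsum_add, ENNReal.tsum_mul_left, (R x).tsum_coe,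
      ← PMF.toOuterMeasure_apply, ← PMF.toOuterMeasure_apply] at h1
    have h2 : ∑' y, (if h : y ∈ F then ENNReal.ofReal (s x ⟨y, h⟩) else 0) =
        ENNReal.ofReal (∑ y, s x y) := by
      rw [ENNReal.ofReal_sum_of_nonneg fun y _ => hs0 x y, tsum_eq_sum (s := F) fun y hy => by simp [hy],
        ← Finset.sum_coe_sort F]
      refine Finset.sum_congr rfl fun y _ => ?_
      simp
    rw [h2] at h1
    have h3 : (1 : ℝ≥0∞) ≤ ENNReal.ofReal (∑ y, s x y) +
        (ENNReal.ofReal η + ENNReal.ofReal K * ENNReal.ofReal (η / K)) := by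
      refine h1.trans ?_
      gcongr
      exact hdom x
    rw [← ENNReal.ofReal_mul hK0.le, mul_div_cancel₀ _ hK0.ne', ← ENNReal.ofReal_add hη0.le hη0.le,
      ← ENNReal.ofReal_add (Finset.sum_nonneg fun y _ => hs0 x y) (by positivity),
      ENNReal.one_le_ofReal] at h3
    linarith
  set σ : ℝ := ∑ y, s x₀ y with hσdef
  have hσ0 : 0 < σ := by linarith [hσ x₀]
  set q : F → ℝ := fun y => (R x₀ y).toReal / σ with hq
  have hq0 : ∀ y, 0 < q y := fun y =>
    div_pos (ENNReal.toReal_pos (hFpos y y.2) (htop _ _)) hσ0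
  have hq1 : ∑ y, q y = 1 := by
    rw [hq, ← Finset.sum_div, hσdef]
    simp only [hsx₀]
    rw [hσdef] at hσ0
    simp only [hsx₀] at hσ0
    exact div_self hσ0.ne'
  have hRq : ∀ y : F, (R x₀ y).toReal ≤ q y := fun y => by
    rw [hq, le_div_iff₀ hσ0]
    exact mul_le_of_le_one_right ENNReal.toReal_nonneg (hσ1 x₀)
  -- The missing mass is returned as a multiple of `q`, which is `R x₀` conditioned on `F`. This
  -- raises the domination constant only to `K + 1` and makes `p x₀ = q`.
  set p : Fin D → F → ℝ := fun x y => s x y + (1 - ∑ y, s x y) * q y with hp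
  have hsp : ∀ x y, s x y ≤ p x y := fun x y => by
    have := mul_nonneg (by linarith [hσ1 x] : 0 ≤ 1 - ∑ y, s x y) (hq0 y).le
    simp only [hp]
    linarith
  have hp1 : ∀ x, ∑ y, p x y = 1 := fun x => by
    rw [hp, Finset.sum_add_distrib, ← Finset.mul_sum, hq1]
    ring
  have hpx₀ : p x₀ = q := by
    funext y
    simp only [hp]
    rw [hsx₀, ← hσdef]
    simp only [hq]
    field_simp
    ring
  have hpq : ∀ x y, p x y ≤ (K + 1) * q y := fun x y => by
    have h1 := hsK x y
    have h2 := mul_le_mul_of_nonneg_left (hRq y) hK0.le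
    have h3 : 0 ≤ ∑ y, s x y := Finset.sum_nonneg fun y _ => hs0 x y
    have h4 := mul_nonneg h3 (hq0 y).le
    simp only [hp]
    linarith
  set φ : (Fin n → F) → ℝ := fun y => (g (List.ofFn fun j => (y j : List Msg)).flatten).toReal
    with hφ
  have hφ1 : ∀ y, |φ y| ≤ 1 := fun y => by
    rw [abs_of_nonneg ENNReal.toReal_nonneg]
    exact ENNReal.toReal_le_of_le_ofReal (by norm_num) (by simpa using hg _)
  have happrox : ∀ X : Fin n → Fin D, |((concatMessages R (List.ofFn X)).expect g).toReal -
      ∑ y : Fin n → F, (∏ j, p (X j) (y j)) * φ y| ≤ n * (2 * η) := fun X =>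
    abs_toReal_expect_sub_sum_le R F s p hs0 hsR hsp hp1 (by linarith) hσ X g hg
  have hclose : ∀ w : Fin (κ + 1) → ℝ, (∀ i, 0 ≤ w i) → ∑ i, w i = 1 →
      |∑ X : Fin n → Fin D, dataWeight x₀ w X *
        ((concatMessages R (List.ofFn X)).expect g).toReal -
      ∑ l : Fin D → Fin (κ + 1), (∏ m, w (l m)) *
        ∑ y, (∏ j, mixDensity n q p l (y j)) * φ y| ≤ n * (2 * η) := by
    intro w hw hw1
    have h1 := sum_dataWeight_mul_sum_prod x₀ w p φ
    rw [hpx₀] at h1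
    rw [← h1, ← Finset.sum_sub_distrib]
    calc _ ≤ ∑ X : Fin n → Fin D, |dataWeight x₀ w X *
          ((concatMessages R (List.ofFn X)).expect g).toReal -
          dataWeight x₀ w X * ∑ y, (∏ j, p (X j) (y j)) * φ y| := Finset.abs_sum_le_sum_abs _ _
      _ ≤ ∑ X : Fin n → Fin D, dataWeight x₀ w X * (n * (2 * η)) := by
          refine Finset.sum_le_sum fun X _ => ?_
          have h2 := dataWeight_nonneg hn hD x₀ hw X
          rw [← mul_sub, abs_mul, abs_of_nonneg h2]
          exact mul_le_mul_of_nonneg_left (happrox X) h2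
      _ = n * (2 * η) := by rw [← Finset.sum_mul, sum_dataWeight x₀ hw1, one_mul]
  have hmain := abs_mixture_sub_mixture_le hn hκ hD q p hq0 hq1
    (fun x y => (hs0 x y).trans (hsp x y)) hp1 (by linarith : 1 ≤ K + 1) hpq u v hu hv hu1 hv1 hmom
    hρ hρ2 φ hφ1
  have hcu := abs_le.1 (hclose u hu hu1)
  have hcv := abs_le.1 (hclose v hv hv1)
  have hm := abs_le.1 hmain
  rw [abs_le]
  constructor <;> linarith

/-! ### Expected number of distinct elements. -/

theorem sum_prod_weight_mul {D κ : ℕ} {u : Fin (κ + 1) → ℝ} (hu1 : ∑ i, u i = 1) (m₀ : Fin D)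
    (f : Fin (κ + 1) → ℝ) :
    ∑ l : Fin D → Fin (κ + 1), (∏ m, u (l m)) * f (l m₀) = ∑ i, u i * f i := by
  have h1 : ∀ l : Fin D → Fin (κ + 1), (∏ m, u (l m)) * f (l m₀) =
      ∏ m, (u (l m) * if m = m₀ then f (l m) else 1) := fun l => by
    rw [Finset.prod_mul_distrib]
    simp
  simp only [h1]
  rw [sum_prod_eq_prod_sum fun m i => u i * if m = m₀ then f i else 1,
    Finset.prod_eq_single m₀ (fun m _ hm => by simp [hm, hu1]) (by simp)]
  simp

theorem countDistinct_eq_sum {n D : ℕ} (X : Fin n → Fin D) :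
    (countDistinct X : ℝ) = ∑ x, if ∃ j, X j = x then 1 else 0 := by
  rw [Finset.sum_boole, countDistinct]
  congr 2
  ext x
  simp

/-- The expected number of distinct elements is small if the intensities are often zero. -/
theorem sum_dataWeight_mul_countDistinct_le {D κ n : ℕ} (hn : 0 < n) (hD : D * node κ ≤ n / 2)
    (x₀ : Fin D) {u : Fin (κ + 1) → ℝ} (hu : ∀ i, 0 ≤ u i) (hu1 : ∑ i, u i = 1) :
    ∑ X : Fin n → Fin D, dataWeight x₀ u X * countDistinct X ≤ 1 + D * (1 - u 0) := by
  rw [sum_dataWeight_mul]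
  have hone : ∀ l : Fin D → Fin (κ + 1), ∑ X : Fin n → Fin D, ∏ j, inputProb n x₀ l (X j) = 1 :=
    fun l => by rw [← Fintype.sum_pow, sum_inputProb, one_pow]
  have h1 : ∀ l : Fin D → Fin (κ + 1),
      ∑ X : Fin n → Fin D, (∏ j, inputProb n x₀ l (X j)) * countDistinct X ≤
        1 + ∑ m, if l m = 0 then 0 else 1 := by
    intro l
    calc _ ≤ ∑ X : Fin n → Fin D, (∏ j, inputProb n x₀ l (X j)) *
          (1 + ∑ m, if l m = 0 then 0 else 1) := by
          refine Finset.sum_le_sum fun X _ => ?_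
          rcases eq_or_ne (∏ j, inputProb n x₀ l (X j)) 0 with h0 | h0
          · rw [h0, zero_mul, zero_mul]
          refine mul_le_mul_of_nonneg_left ?_
            (Finset.prod_nonneg fun j _ => inputProb_nonneg hn hD x₀ l _)
          -- In a dataset of nonzero probability every element other than `x₀` has nonzero
          -- intensity; the `1` in the bound pays for `x₀`.
          have hX : ∀ j, X j = x₀ ∨ l (X j) ≠ 0 := fun j => by
            by_contra hcon
            push Not at hcon
            refine (Finset.prod_ne_zero_iff.1 h0) j (Finset.mem_univ _) ?_
            rw [inputProb, if_neg hcon.1, hcon.2]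
            simp [node]
          rw [countDistinct_eq_sum]
          calc _ ≤ ∑ x, ((if x = x₀ then (1 : ℝ) else 0) + if l x = 0 then 0 else 1) := by
                refine Finset.sum_le_sum fun x _ => ?_
                by_cases hx : ∃ j, X j = x
                · obtain ⟨j, rfl⟩ := hx
                  rw [if_pos ⟨j, rfl⟩]
                  rcases hX j with h | h
                  · rw [if_pos h]
                    split_ifs <;> norm_num
                  · rw [if_neg h]
                    split_ifs <;> norm_num
                · rw [if_neg hx]
                  split_ifs <;> norm_num
            _ = _ := by rw [Finset.sum_add_distrib]; simp
      _ = _ := by rw [← Finset.sum_mul, hone, one_mul]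
  calc _ ≤ ∑ l : Fin D → Fin (κ + 1), (∏ m, u (l m)) * (1 + ∑ m, if l m = 0 then 0 else 1) :=
        Finset.sum_le_sum fun l _ => mul_le_mul_of_nonneg_left (h1 l)
          (Finset.prod_nonneg fun m _ => hu _)
    _ = 1 + D * (1 - u 0) := by
        simp only [mul_add, mul_one, Finset.sum_add_distrib, sum_prod_weight hu1, Finset.mul_sum]
        rw [Finset.sum_comm]
        have h2 : ∀ m : Fin D, ∑ l : Fin D → Fin (κ + 1),
            (∏ m, u (l m)) * (if l m = 0 then (0 : ℝ) else 1) = 1 - u 0 := fun m => by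
          rw [sum_prod_weight_mul hu1 m fun i => if i = 0 then (0 : ℝ) else 1, Fin.sum_univ_succ]
          have h3 := hu1
          rw [Fin.sum_univ_succ] at h3
          simp [Fin.succ_ne_zero]
          linarith
        simp only [h2, Finset.sum_const, Finset.card_univ, Fintype.card_fin, nsmul_eq_mul]

/-- Almost all elements are expected to occur if the intensities are never zero. -/
theorem sum_dataWeight_mul_sub_countDistinct_le {D κ n : ℕ} (hn : 0 < n)
    (hD : D * node κ ≤ n / 2) (x₀ : Fin D) {v : Fin (κ + 1) → ℝ} (hv : ∀ i, 0 ≤ v i)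
    (hv1 : ∑ i, v i = 1) (hv0 : v 0 = 0) :
    ∑ X : Fin n → Fin D, dataWeight x₀ v X * (D - countDistinct X) ≤ D * Real.exp (-8) := by
  have hn' : (0 : ℝ) < n := by exact_mod_cast hn
  rw [sum_dataWeight_mul]
  -- Writing absence as a product over the users lets the expectation factor.
  have hmiss : ∀ X : Fin n → Fin D, (D : ℝ) - countDistinct X =
      ∑ x, ∏ j, if X j = x then (0 : ℝ) else 1 := fun X => by
    have : (D : ℝ) = ∑ _x : Fin D, (1 : ℝ) := by simp
    rw [countDistinct_eq_sum, this, ← Finset.sum_sub_distrib]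
    refine Finset.sum_congr rfl fun x _ => ?_
    by_cases hx : ∃ j, X j = x
    · rw [if_pos hx, sub_self]
      obtain ⟨j, hj⟩ := hx
      exact (Finset.prod_eq_zero (f := fun j => if X j = x then (0 : ℝ) else 1)
        (Finset.mem_univ j) (if_pos hj)).symm
    · rw [if_neg hx, sub_zero]
      push Not at hx
      exact (Finset.prod_eq_one fun j _ => if_neg (hx j)).symm
  have h1 : ∀ l : Fin D → Fin (κ + 1),
      ∑ X : Fin n → Fin D, (∏ j, inputProb n x₀ l (X j)) * (D - countDistinct X) ≤
        ∑ x, Real.exp (-node (l x)) := by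
    intro l
    simp only [hmiss, Finset.mul_sum, ← Finset.prod_mul_distrib]
    rw [Finset.sum_comm]
    refine Finset.sum_le_sum fun x _ => ?_
    rw [sum_prod_eq_prod_sum fun (_ : Fin n) z => inputProb n x₀ l z * if z = x then (0 : ℝ) else 1,
      Finset.prod_const, Finset.card_univ, Fintype.card_fin]
    have h2 : ∑ z, inputProb n x₀ l z * (if z = x then (0 : ℝ) else 1) =
        1 - inputProb n x₀ l x := by
      rw [eq_sub_iff_add_eq]
      refine Eq.trans ?_ (sum_inputProb n x₀ l)
      have : inputProb n x₀ l x = ∑ z, inputProb n x₀ l z * if z = x then (1 : ℝ) else 0 := by simp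
      rw [this, ← Finset.sum_add_distrib]
      refine Finset.sum_congr rfl fun z _ => ?_
      split_ifs <;> simp
    rw [h2]
    have h3 : node (l x) / n ≤ inputProb n x₀ l x := by
      rw [inputProb]
      have := sum_node_div_le hn hD l
      split_ifs <;> linarith
    have h4 : inputProb n x₀ l x ≤ 1 := by
      rw [← sum_inputProb n x₀ l]
      exact Finset.single_le_sum (f := inputProb n x₀ l)
        (fun z _ => inputProb_nonneg hn hD x₀ l z) (Finset.mem_univ x)
    calc (1 - inputProb n x₀ l x) ^ n ≤ Real.exp (-(node (l x) / n)) ^ n := by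
          refine pow_le_pow_left₀ (by linarith) ?_ n
          linarith [Real.add_one_le_exp (-(node (l x) / n))]
      _ = Real.exp (-node (l x)) := by
          rw [← Real.exp_nat_mul]
          congr 1
          field_simp
  calc _ ≤ ∑ l : Fin D → Fin (κ + 1), (∏ m, v (l m)) * ∑ x, Real.exp (-node (l x)) :=
        Finset.sum_le_sum fun l _ => mul_le_mul_of_nonneg_left (h1 l)
          (Finset.prod_nonneg fun m _ => hv _)
    _ = ∑ _x : Fin D, ∑ i, v i * Real.exp (-node i) := by
        simp only [Finset.mul_sum]
        rw [Finset.sum_comm]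
        exact Finset.sum_congr rfl fun x _ =>
          sum_prod_weight_mul hv1 x fun i => Real.exp (-node i)
    -- The smallest nonzero node is `8`, and `v` never selects the node `0`.
    _ ≤ ∑ _x : Fin D, Real.exp (-8) := by
        refine Finset.sum_le_sum fun x _ => ?_
        calc ∑ i, v i * Real.exp (-node i) ≤ ∑ i, v i * Real.exp (-8) := by
              refine Finset.sum_le_sum fun i _ => ?_
              rcases eq_or_ne i 0 with rfl | hi
              · simp [hv0]
              · refine mul_le_mul_of_nonneg_left (Real.exp_le_exp.2 (neg_le_neg ?_)) (hv i)
                have h5 : 1 ≤ (i : ℕ) := Nat.one_le_iff_ne_zero.2 fun h => hi (Fin.ext h)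
                have h6 := node_mono h5
                simpa [node] using h6
          _ = Real.exp (-8) := by rw [← Finset.sum_mul, hv1, one_mul]
    _ = D * Real.exp (-8) := by simp

/-! ### Averaging over the public random string. -/

theorem PMF.expect_mono_support {α : Type*} (P : PMF α) {f g : α → ℝ≥0∞}
    (h : ∀ x ∈ P.support, f x ≤ g x) : P.expect f ≤ P.expect g := by
  refine ENNReal.tsum_le_tsum fun x => ?_
  by_cases hx : x ∈ P.support
  · gcongr
    exact h x hx
  · rw [(P.apply_eq_zero_iff x).2 hx, zero_mul, zero_mul]

/-- The expected value of a test on the sequence of messages in shuffled form. -/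
theorem ShuffleProtocol.toOuterMeasure_output {Coin Msg 𝒳 : Type*}
    (P : ShuffleProtocol Coin Msg 𝒳) {n : ℕ} (X : Fin n → 𝒳) (A : Set ℝ) :
    (P.output X).toOuterMeasure A = P.pub.expect fun a =>
      (concatMessages (P.randomizer a) (List.ofFn X)).expect fun l =>
        (shuffler l).expect fun l' => (P.analyzer a l').toOuterMeasure A := by
  simp only [PMF.toOuterMeasure_eq_expect, ShuffleProtocol.output, ShuffleProtocol.view,
    PMF.expect_bind, PMF.expect_map]

/-- The public random strings for which the protocol is not private between the constant dataset
and one of its neighbors. -/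
def ShuffleProtocol.nonprivateCoins {Coin Msg 𝒳 : Type*} (P : ShuffleProtocol Coin Msg 𝒳)
    (m : ℕ) (ε δ : ℝ) (x₀ : 𝒳) : Set Coin :=
  ⋃ x, {a | ∃ S, ENNReal.ofReal (Real.exp ε) *
      (shuffledMessages (P.randomizer a) (fun _ : Fin (m + 1) => x₀)).toOuterMeasure S +
        ENNReal.ofReal δ <
      (shuffledMessages (P.randomizer a) (Fin.cons x fun _ : Fin m => x₀)).toOuterMeasure S}

theorem neighboring_cons {𝒳 : Type*} {m : ℕ} (x₀ x : 𝒳) :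
    Neighboring (Fin.cons x fun _ : Fin m => x₀ : Fin (m + 1) → 𝒳) (fun _ => x₀) := by
  refine ⟨1, 0, fun j hj => ?_⟩
  obtain ⟨i, rfl⟩ := Fin.exists_succ_eq.2 hj
  simp

/-- With slack `100 * D * δ`, each input `x` has bad coins of probability at most `1 / (100 * D)`; a
union bound over the `D` inputs gives `0.01`. -/
theorem ShuffleProtocol.toOuterMeasure_nonprivateCoins_le {Coin Msg : Type*} {D m : ℕ}
    (P : ShuffleProtocol Coin Msg (Fin D)) {ε δ : ℝ} (hδ : 0 < δ) (hD : 0 < D)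
    (h : P.IsShuffleDP (m + 1) ε δ) (x₀ : Fin D) :
    P.pub.toOuterMeasure (P.nonprivateCoins m ε (100 * D * δ) x₀) ≤ ENNReal.ofReal 0.01 := by
  have hD' : (0 : ℝ) < D := by exact_mod_cast hD
  refine (MeasureTheory.measure_iUnion_fintype_le _ _).trans ?_
  calc _ ≤ ∑ _x : Fin D, ENNReal.ofReal (1 / (100 * D)) := by
        refine Finset.sum_le_sum fun x _ => ?_
        have h1 := P.toOuterMeasure_not_private_mul_le h _ _ (neighboring_cons (m := m) x₀ x)
          (ENNReal.ofReal (100 * D * δ))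
        rw [← ENNReal.le_div_iff_mul_le
          (Or.inl (ENNReal.ofReal_pos.2 (by positivity)).ne') (Or.inl ENNReal.ofReal_ne_top),
          ← ENNReal.ofReal_div_of_pos (by positivity)] at h1
        refine h1.trans (ENNReal.ofReal_le_ofReal (le_of_eq ?_))
        field_simp
    _ = ENNReal.ofReal 0.01 := by
        rw [Finset.sum_const, Finset.card_univ, Fintype.card_fin, nsmul_eq_mul,
          ← ENNReal.ofReal_natCast, ← ENNReal.ofReal_mul hD'.le]
        congr 1
        field_simp
        norm_num

theorem exp_neg_eight_le : Real.exp (-8) ≤ 0.0005 := by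
  have h1 : (2.7 : ℝ) ≤ Real.exp 1 := by linarith [Real.exp_one_gt_d9]
  have h2 : (2.7 : ℝ) ^ 8 ≤ Real.exp 8 := by
    calc (2.7 : ℝ) ^ 8 ≤ Real.exp 1 ^ 8 := pow_le_pow_left₀ (by norm_num) h1 8
      _ = Real.exp 8 := by rw [← Real.exp_nat_mul]; norm_num
  rw [Real.exp_neg]
  refine inv_le_of_inv_le₀ (by norm_num) (le_trans ?_ h2)
  norm_num

theorem toReal_toOuterMeasure_output_ge {Coin Msg : Type*} {D n : ℕ}
    {P : ShuffleProtocol Coin Msg (Fin D)} {e : ℝ} (hP : P.SolvesCountDistinct n e)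
    (X : Fin n → Fin D) {A : Set ℝ} (hA : ∀ z : ℝ, |z - countDistinct X| ≤ e → z ∈ A) :
    0.99 ≤ ((P.output X).toOuterMeasure A).toReal := by
  rw [← ENNReal.ofReal_le_iff_le_toReal
    (ne_top_of_le_ne_top ENNReal.one_ne_top (PMF.toOuterMeasure_le_one _ _))]
  exact (hP X).trans (MeasureTheory.measure_mono fun z hz => hA z hz)

theorem toReal_toOuterMeasure_output_le {Coin Msg : Type*} {D n : ℕ}
    {P : ShuffleProtocol Coin Msg (Fin D)} {e : ℝ} (hP : P.SolvesCountDistinct n e)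
    (X : Fin n → Fin D) {A : Set ℝ} (hA : ∀ z : ℝ, |z - countDistinct X| ≤ e → z ∉ A) :
    ((P.output X).toOuterMeasure A).toReal ≤ 0.01 := by
  have h1 := toReal_toOuterMeasure_output_ge hP X (A := Aᶜ) hA
  have h2 := congrArg ENNReal.toReal ((P.output X).toOuterMeasure_add_compl A)
  rw [ENNReal.toReal_add
    (ne_top_of_le_ne_top ENNReal.one_ne_top (PMF.toOuterMeasure_le_one _ _))
    (ne_top_of_le_ne_top ENNReal.one_ne_top (PMF.toOuterMeasure_le_one _ _)),
    ENNReal.toReal_one] at h2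
  norm_num at h1 h2 ⊢
  linarith

/-- If for most public random strings the averages of a test over two weighted families of datasets
are close, then so are the averages of the test over the public random string. -/
theorem sum_mul_toReal_output_le {Coin Msg 𝒳 : Type*} [Fintype 𝒳]
    (P : ShuffleProtocol Coin Msg 𝒳) {n : ℕ} (A : Set ℝ) (w w' : (Fin n → 𝒳) → ℝ)
    (hw : ∀ X, 0 ≤ w X) (hw' : ∀ X, 0 ≤ w' X) (hw1 : ∑ X, w X = 1) {γ ζ : ℝ} (hγ : 0 ≤ γ)
    (hζ : 0 ≤ ζ) (B : Set Coin) (hB : P.pub.toOuterMeasure B ≤ ENNReal.ofReal ζ)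
    (h : ∀ a ∈ P.pub.support, a ∉ B → ∀ g : List Msg → ℝ≥0∞, (∀ l, g l ≤ 1) →
      ∑ X, w X * ((concatMessages (P.randomizer a) (List.ofFn X)).expect g).toReal ≤
        ∑ X, w' X * ((concatMessages (P.randomizer a) (List.ofFn X)).expect g).toReal + γ) :
    ∑ X, w X * ((P.output X).toOuterMeasure A).toReal ≤
      ∑ X, w' X * ((P.output X).toOuterMeasure A).toReal + γ + ζ := by
  -- Shuffler and analyzer merge into a single test of the ordered messages. It varies with the
  -- coin, hence the quantification over all `g` in the hypothesis.
  set g : Coin → List Msg → ℝ≥0∞ := fun a l =>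
    (shuffler l).expect fun l' => (P.analyzer a l').toOuterMeasure A with hg
  set G : (Fin n → 𝒳) → Coin → ℝ≥0∞ := fun X a =>
    (concatMessages (P.randomizer a) (List.ofFn X)).expect (g a) with hG
  have hg1 : ∀ a l, g a l ≤ 1 := fun a l =>
    PMF.expect_le_one _ fun l' => PMF.toOuterMeasure_le_one _ _
  have hG1 : ∀ X a, G X a ≤ 1 := fun X a => PMF.expect_le_one _ (hg1 a)
  have hGtop : ∀ X a, G X a ≠ ⊤ := fun X a => ne_top_of_le_ne_top ENNReal.one_ne_top (hG1 X a)
  have hout : ∀ X, (P.output X).toOuterMeasure A = P.pub.expect (G X) := fun X =>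
    P.toOuterMeasure_output X A
  have houttop : ∀ X : Fin n → 𝒳, (P.output X).toOuterMeasure A ≠ ⊤ := fun X =>
    ne_top_of_le_ne_top ENNReal.one_ne_top (PMF.toOuterMeasure_le_one _ _)
  have hconv : ∀ r : (Fin n → 𝒳) → ℝ, (∀ X, 0 ≤ r X) →
      ENNReal.ofReal (∑ X, r X * ((P.output X).toOuterMeasure A).toReal) =
        P.pub.expect fun a => ∑ X, ENNReal.ofReal (r X) * G X a := by
    intro r hr
    rw [PMF.expect_sum, ENNReal.ofReal_sum_of_nonneg fun X _ =>
      mul_nonneg (hr X) ENNReal.toReal_nonneg]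
    refine Finset.sum_congr rfl fun X _ => ?_
    rw [ENNReal.ofReal_mul (hr X), ENNReal.ofReal_toReal (houttop X), hout, PMF.expect_mul_left]
  have hconv' : ∀ (r : (Fin n → 𝒳) → ℝ) (a : Coin), (∀ X, 0 ≤ r X) →
      ∑ X, ENNReal.ofReal (r X) * G X a = ENNReal.ofReal (∑ X, r X * (G X a).toReal) := by
    intro r a hr
    rw [ENNReal.ofReal_sum_of_nonneg fun X _ => mul_nonneg (hr X) ENNReal.toReal_nonneg]
    refine Finset.sum_congr rfl fun X _ => ?_
    rw [ENNReal.ofReal_mul (hr X), ENNReal.ofReal_toReal (hGtop X a)]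
  have hnonneg : ∀ (r : (Fin n → 𝒳) → ℝ) (f : (Fin n → 𝒳) → ℝ≥0∞), (∀ X, 0 ≤ r X) →
      0 ≤ ∑ X, r X * (f X).toReal := fun r f hr =>
    Finset.sum_nonneg fun X _ => mul_nonneg (hr X) ENNReal.toReal_nonneg
  have hw'0 := hnonneg w' (fun X => (P.output X).toOuterMeasure A) hw'
  rw [← ENNReal.ofReal_le_ofReal_iff (by positivity), ENNReal.ofReal_add (by positivity) hζ,
    ENNReal.ofReal_add hw'0 hγ, hconv w hw, hconv w' hw']
  calc (P.pub.expect fun a => ∑ X, ENNReal.ofReal (w X) * G X a)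
      ≤ P.pub.expect fun a => ((∑ X, ENNReal.ofReal (w' X) * G X a) + ENNReal.ofReal γ) +
        B.indicator 1 a := by
        refine PMF.expect_mono_support _ fun a ha => ?_
        by_cases haB : a ∈ B
        · rw [Set.indicator_of_mem haB, Pi.one_apply]
          refine le_trans ?_ le_add_self
          calc ∑ X, ENNReal.ofReal (w X) * G X a ≤ ∑ X, ENNReal.ofReal (w X) * 1 :=
                Finset.sum_le_sum fun X _ => by gcongr; exact hG1 X a
            _ = 1 := by
                simp only [mul_one]
                rw [← ENNReal.ofReal_sum_of_nonneg fun X _ => hw X, hw1, ENNReal.ofReal_one]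
        · rw [Set.indicator_of_notMem haB, add_zero, hconv' w a hw, hconv' w' a hw',
            ← ENNReal.ofReal_add (hnonneg w' (fun X => G X a) hw') hγ]
          exact ENNReal.ofReal_le_ofReal (h a ha haB (g a) (hg1 a))
    _ = (P.pub.expect fun a => ∑ X, ENNReal.ofReal (w' X) * G X a) + ENNReal.ofReal γ +
        P.pub.toOuterMeasure B := by
        rw [PMF.expect_add, PMF.expect_add, PMF.expect_const, PMF.toOuterMeasure_eq_expect]
    _ ≤ _ := by gcongr

/-! ### The contradiction for a fixed number of users. -/

/-- The lower bound for a fixed number of users, in terms of the number `κ` of nodes and the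
threshold `T` of the privacy test. -/
theorem not_solvesCountDistinct {Coin Msg : Type*} {D κ m T : ℕ}
    (P : ShuffleProtocol Coin Msg (Fin D)) (hP : P.SendsAtMost 1) {ε δ e C η ρ : ℝ}
    (hδ0 : 0 < δ) (hDP : P.IsShuffleDP (m + 1) ε δ) (hεC : Real.exp ε ≤ C) (hC : 1 ≤ C)
    (hT : 0 < T) (hTm : T ≤ m + 1) (hη0 : 0 < η) (hη : (m + 1) * (4 * η) ≤ 0.01)
    (hδ : 4 * (100 * D * δ) ≤ η)
    (hδT : 2 * (100 * D * δ) ≤ η * (η / (4 * C * (m + 1) * Real.exp 1)) ^ T)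
    (hκ : 0 < κ) (hD : D * node κ ≤ (m + 1) / 2) (hD100 : 100 ≤ D)
    (hρ : Real.exp 1 * (4 * (2 * C * (m + 1) / T + 1) * node κ ^ 2 / (m + 1)) ≤ ρ * κ)
    (hρ2 : ρ ≤ 1 / 2) (hDρ : D * √(8 * ρ ^ κ) ≤ 0.01) (he : e ≤ 0.01 * D) :
    ¬ P.SolvesCountDistinct (m + 1) e := by
  intro hsol
  have hD0 : 0 < D := by omega
  have hD' : (100 : ℝ) ≤ D := by exact_mod_cast hD100
  have hm : (0 : ℝ) ≤ m := Nat.cast_nonneg m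
  have hT' : (0 : ℝ) < T := by exact_mod_cast hT
  have hη1 : η ≤ 0.0025 := by norm_num at hη ⊢; nlinarith
  have hcast : ((m + 1 : ℕ) : ℝ) = m + 1 := by push_cast; ring
  have hD2 : D * node κ ≤ ((m + 1 : ℕ) : ℝ) / 2 := by rw [hcast]; exact hD
  obtain ⟨u, v, hu, hv, hu1, hv1, hu0, hv0, hmom⟩ := exists_moment_matching κ hκ
  let x₀ : Fin D := ⟨0, hD0⟩
  -- The threshold lies between the typical counts, about `0.75 * D` at most under `u` and nearly
  -- `D` under `v`, with room for the error `0.01 * D`.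
  set A : Set ℝ := {z | z ≤ 0.9 * D} with hA
  have hK : 1 ≤ 2 * C * (m + 1) / T := by
    have : (T : ℝ) ≤ m + 1 := by exact_mod_cast hTm
    rw [le_div_iff₀ hT']
    nlinarith
  have hclose := sum_mul_toReal_output_le P A (dataWeight (n := m + 1) x₀ u) (dataWeight x₀ v)
    (dataWeight_nonneg (Nat.succ_pos m) hD2 x₀ hu) (dataWeight_nonneg (Nat.succ_pos m) hD2 x₀ hv)
    (sum_dataWeight x₀ hu1) (γ := 0.02) (ζ := 0.01) (by norm_num) (by norm_num)
    (P.nonprivateCoins m ε (100 * D * δ) x₀)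
    (P.toOuterMeasure_nonprivateCoins_le hδ0 hD0 hDP x₀) (fun a ha haB g hg => by
      have hpriv : ∀ x S, (shuffledMessages (P.randomizer a)
          (Fin.cons x fun _ : Fin m => x₀)).toOuterMeasure S ≤ ENNReal.ofReal (Real.exp ε) *
          (shuffledMessages (P.randomizer a) (fun _ : Fin (m + 1) => x₀)).toOuterMeasure S +
            ENNReal.ofReal (100 * D * δ) := fun x S => by
        by_contra hcon
        exact haB (Set.mem_iUnion.2 ⟨x, S, not_le.1 hcon⟩)
      have hdom : ∀ x, (P.randomizer a x).toOuterMeasure {y | ¬ P.randomizer a x y ≤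
          ENNReal.ofReal (2 * C * (m + 1) / T) * P.randomizer a x₀ y} ≤ ENNReal.ofReal η :=
        fun x => toOuterMeasure_not_dominated_le (hP a ha) (by positivity) hεC hT hTm hC hη0
          (by linarith) hδ hδT x₀ x (hpriv x)
      have h1 := abs_sum_dataWeight_mul_expect_sub_le (n := m + 1) (P.randomizer a) x₀ hK hη0
        (by linarith) hdom (Nat.succ_pos m) hκ hD2 u v hu hv hu1 hv1 hmom
        (by rw [hcast]; exact hρ) hρ2 g hg
      rw [hcast] at h1
      have h2 := (abs_le.1 h1).2
      norm_num at hη hDρ h2 ⊢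
      linarith)
  have hlow : 0.1 ≤ ∑ X : Fin (m + 1) → Fin D,
      dataWeight x₀ u X * ((P.output X).toOuterMeasure A).toReal := by
    -- Markov's inequality in linear form: an affine minorant of the acceptance probability, so only
    -- the mean count is needed. The analogous majorant serves for `v`.
    have h1 : ∀ X : Fin (m + 1) → Fin D, 0.99 - 0.99 / (0.85 * D) * countDistinct X ≤
        ((P.output X).toOuterMeasure A).toReal := by
      intro X
      rcases le_or_gt (countDistinct X : ℝ) (0.85 * D) with h | h
      · have h2 := toReal_toOuterMeasure_output_ge hsol X (A := A) fun z hz => by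
          have h3 := (abs_le.1 hz).2
          simp only [hA, Set.mem_ofPred_eq]
          norm_num at h he ⊢
          linarith
        have h4 : 0 ≤ 0.99 / (0.85 * D) * (countDistinct X : ℝ) := by positivity
        linarith
      · refine le_trans ?_ ENNReal.toReal_nonneg
        have h4 : (0.99 : ℝ) ≤ 0.99 / (0.85 * D) * countDistinct X := by
          rw [div_mul_eq_mul_div, le_div_iff₀ (by positivity)]
          exact mul_le_mul_of_nonneg_left h.le (by norm_num)
        linarith
    have h2 := sum_dataWeight_mul_countDistinct_le (Nat.succ_pos m) hD2 x₀ hu hu1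
    calc (0.1 : ℝ) ≤ 0.99 - 0.99 / (0.85 * D) * (1 + D * (1 - 1 / 4)) := by
          rw [le_sub_comm, div_mul_eq_mul_div, div_le_iff₀ (by positivity)]
          norm_num
          linarith
      _ ≤ 0.99 - 0.99 / (0.85 * D) *
          ∑ X : Fin (m + 1) → Fin D, dataWeight x₀ u X * countDistinct X := by
          refine sub_le_sub_left (mul_le_mul_of_nonneg_left (h2.trans ?_) (by positivity)) _
          nlinarith
      _ = ∑ X : Fin (m + 1) → Fin D, dataWeight x₀ u X *
          (0.99 - 0.99 / (0.85 * D) * countDistinct X) := by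
          simp only [mul_sub, Finset.sum_sub_distrib, ← Finset.sum_mul, sum_dataWeight x₀ hu1,
            one_mul, Finset.mul_sum]
          congr 1
          exact Finset.sum_congr rfl fun X _ => by ring
      _ ≤ _ := Finset.sum_le_sum fun X _ => mul_le_mul_of_nonneg_left (h1 X)
          (dataWeight_nonneg (Nat.succ_pos m) hD2 x₀ hu X)
  have hup : ∑ X : Fin (m + 1) → Fin D,
      dataWeight x₀ v X * ((P.output X).toOuterMeasure A).toReal ≤ 0.02 := by
    have h1 : ∀ X : Fin (m + 1) → Fin D, ((P.output X).toOuterMeasure A).toReal ≤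
        0.01 + 1 / (0.05 * D) * (D - countDistinct X) := by
      intro X
      have hcd : (countDistinct X : ℝ) ≤ D := by
        exact_mod_cast (Finset.card_le_univ _).trans (by simp)
      rcases le_or_gt (0.95 * (D : ℝ)) (countDistinct X : ℝ) with h | h
      · have h2 := toReal_toOuterMeasure_output_le hsol X (A := A) fun z hz hzA => by
          have h3 := (abs_le.1 hz).1
          simp only [hA, Set.mem_ofPred_eq] at hzA
          norm_num at h he hzA
          linarith
        have h4 : 0 ≤ 1 / (0.05 * D) * ((D : ℝ) - countDistinct X) :=
          mul_nonneg (by positivity) (by linarith)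
        linarith
      · have h3 : ((P.output X).toOuterMeasure A).toReal ≤ 1 :=
          ENNReal.toReal_le_of_le_ofReal (by norm_num)
            (by simpa using PMF.toOuterMeasure_le_one _ _)
        have h4 : (1 : ℝ) ≤ 1 / (0.05 * D) * ((D : ℝ) - countDistinct X) := by
          rw [div_mul_eq_mul_div, le_div_iff₀ (by positivity)]
          norm_num at h ⊢
          linarith
        norm_num at h4 ⊢
        linarith
    have h2 := sum_dataWeight_mul_sub_countDistinct_le (Nat.succ_pos m) hD2 x₀ hv hv1 hv0
    calc _ ≤ ∑ X : Fin (m + 1) → Fin D, dataWeight x₀ v X *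
          (0.01 + 1 / (0.05 * D) * (D - countDistinct X)) :=
          Finset.sum_le_sum fun X _ => mul_le_mul_of_nonneg_left (h1 X)
            (dataWeight_nonneg (Nat.succ_pos m) hD2 x₀ hv X)
      _ = 0.01 + 1 / (0.05 * D) *
          ∑ X : Fin (m + 1) → Fin D, dataWeight x₀ v X * (D - countDistinct X) := by
          simp only [mul_add, Finset.sum_add_distrib, ← Finset.sum_mul, sum_dataWeight x₀ hv1,
            one_mul, Finset.mul_sum]
          congr 1
          exact Finset.sum_congr rfl fun X _ => by ring
      _ ≤ 0.01 + 1 / (0.05 * D) * (D * 0.0005) := by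
          have h3 := mul_le_mul_of_nonneg_left exp_neg_eight_le (by linarith : (0 : ℝ) ≤ D)
          gcongr
          exact h2.trans h3
      _ = 0.02 := by
          field_simp
          norm_num
  -- The bounds collide: `0.1 ≤ 0.02 + 0.02 + 0.01`.
  norm_num at hlow hup hclose
  linarith

/-! ### Choice of the parameters and their asymptotics. -/

/-- The number of nonzero nodes used for `n` users. -/
noncomputable def nodeCount (n : ℕ) : ℕ := ⌊Real.log n⌋₊ + 1

theorem log_le_nodeCount (n : ℕ) : Real.log n ≤ nodeCount n := by
  rw [nodeCount]
  push_cast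
  exact (Nat.lt_floor_add_one _).le

theorem tendsto_log_natCast : Tendsto (fun n : ℕ => Real.log n) atTop atTop :=
  Real.tendsto_log_atTop.comp tendsto_natCast_atTop_atTop

theorem nodeCount_isTheta_log :
    (fun n => (nodeCount n : ℝ)) =Θ[atTop] fun n : ℕ => Real.log n := by
  constructor
  · refine IsBigO.of_bound 2 ?_
    filter_upwards [tendsto_log_natCast.eventually_ge_atTop 1] with n hn
    rw [Real.norm_of_nonneg (Nat.cast_nonneg _), Real.norm_of_nonneg (by linarith), nodeCount]
    push_cast
    linarith [Nat.floor_le (show 0 ≤ Real.log n by linarith)]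
  · refine IsBigO.of_bound 1 ?_
    filter_upwards with n
    rw [Real.norm_of_nonneg (Nat.cast_nonneg _), Real.norm_of_nonneg (Real.log_natCast_nonneg n),
      one_mul]
    exact log_le_nodeCount n

theorem eventually_mul_nodeCount_pow_le (c : ℝ) (k : ℕ) :
    ∀ᶠ n : ℕ in atTop, c * (nodeCount n : ℝ) ^ k ≤ n := by
  have h1 : (fun n : ℕ => Real.log n ^ k) =o[atTop] fun n : ℕ => (n : ℝ) :=
    (Real.isLittleO_pow_log_id_atTop (n := k)).comp_tendsto tendsto_natCast_atTop_atTop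
  have h2 := ((nodeCount_isTheta_log.pow k).1.trans_isLittleO h1).const_mul_left c
  filter_upwards [h2.bound one_pos] with n hn
  rw [one_mul, Real.norm_of_nonneg (Nat.cast_nonneg n)] at hn
  exact (le_abs_self _).trans hn

/-- The size of the universe for `n` users. -/
noncomputable def universeSize (n : ℕ) : ℕ := n / (16 * nodeCount n ^ 4)

theorem universeSize_isTheta :
    (fun n => (universeSize n : ℝ)) =Θ[atTop] fun n : ℕ => (n : ℝ) / Real.log n ^ 4 := by
  have hpos : ∀ n, 0 < nodeCount n := fun n => Nat.succ_pos _
  have h1 : (fun n => (universeSize n : ℝ)) =Θ[atTop]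
      fun n : ℕ => (n : ℝ) / (16 * (nodeCount n : ℝ) ^ 4) := by
    constructor
    · refine IsBigO.of_bound 1 ?_
      filter_upwards with n
      rw [Real.norm_of_nonneg (Nat.cast_nonneg _), Real.norm_of_nonneg (by positivity), one_mul]
      refine Nat.cast_div_le.trans (le_of_eq ?_)
      push_cast
      rfl
    · refine IsBigO.of_bound 2 ?_
      -- Once the quotient is at least `1`, rounding down costs at most a factor `2`.
      filter_upwards [eventually_mul_nodeCount_pow_le 16 4] with n hn
      have hκ := hpos n
      rw [Real.norm_of_nonneg (by positivity), Real.norm_of_nonneg (Nat.cast_nonneg _)]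
      have hden : 0 < 16 * nodeCount n ^ 4 := by positivity
      have h2 : 1 ≤ universeSize n := by
        rw [universeSize, Nat.le_div_iff_mul_le hden, one_mul]
        exact_mod_cast hn
      have h3 : n < (16 * nodeCount n ^ 4) * (universeSize n + 1) := Nat.lt_mul_div_succ n hden
      have h4 : (n : ℝ) ≤ 16 * (nodeCount n : ℝ) ^ 4 * (universeSize n + 1) := by
        exact_mod_cast h3.le
      have h5 : (1 : ℝ) ≤ universeSize n := by exact_mod_cast h2
      have hden' : (0 : ℝ) < 16 * (nodeCount n : ℝ) ^ 4 := by exact_mod_cast hden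
      rw [div_le_iff₀ hden']
      nlinarith
  refine h1.trans ((isTheta_refl _ _).div ?_)
  exact (nodeCount_isTheta_log.pow 4).const_mul_left (by norm_num)

/-- The threshold of the privacy test for `n` users. -/
noncomputable def testThreshold (C : ℝ) (n : ℕ) : ℕ :=
  ⌈768 * Real.exp 5 * C⌉₊ * nodeCount n ^ 7

/-- The privacy parameter for `n` users. -/
noncomputable def privacyDelta (C : ℝ) (n : ℕ) : ℝ := Real.exp (-(8 * testThreshold C n * Real.log n))

theorem privacyDelta_eq (C : ℝ) {n : ℕ} (hn : 0 < n) :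
    privacyDelta C n = ((n : ℝ) ^ (8 * testThreshold C n))⁻¹ := by
  have hn' : (0 : ℝ) < n := by exact_mod_cast hn
  rw [privacyDelta, Real.exp_neg]
  congr 1
  rw [← Real.exp_log (pow_pos hn' _), Real.log_pow]
  push_cast
  rfl

theorem neg_logb_privacyDelta_isTheta {C : ℝ} (hC : 0 < C) :
    (fun n => -Real.logb 2 (privacyDelta C n)) =Θ[atTop] fun n : ℕ => Real.log n ^ 8 := by
  have h1 : (fun n => -Real.logb 2 (privacyDelta C n)) = fun n : ℕ =>
      (8 * (⌈768 * Real.exp 5 * C⌉₊ : ℝ) / Real.log 2) * ((nodeCount n : ℝ) ^ 7 * Real.log n) := by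
    funext n
    rw [privacyDelta, Real.logb, Real.log_exp, testThreshold]
    push_cast
    ring
  have hN : 0 < ⌈768 * Real.exp 5 * C⌉₊ := Nat.ceil_pos.2 (by positivity)
  have hlog : 0 < Real.log 2 := Real.log_pos (by norm_num)
  rw [h1]
  refine IsTheta.const_mul_left (by positivity) ?_
  have h2 : (fun n : ℕ => Real.log n ^ 8) = fun n : ℕ => Real.log n ^ 7 * Real.log n := by
    funext n; ring
  rw [h2]
  exact (nodeCount_isTheta_log.pow 7).mul (isTheta_refl _ _)

theorem exp_neg_four_le : Real.exp (-4) ≤ 1 / 2 := by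
  have h := Real.add_one_le_exp (4 : ℝ)
  rw [Real.exp_neg]
  exact inv_le_of_inv_le₀ (by norm_num) (by linarith)

/-- The numerical conditions of the lower bound hold for large `n`. -/
theorem eventually_not_solvesCountDistinct {ε e : ℕ → ℝ} {C : ℝ} (hC : 1 ≤ C)
    (hε : ∀ᶠ n in atTop, Real.exp (ε n) ≤ C)
    (he : e =o[atTop] fun n => (universeSize n : ℝ)) :
    ∀ᶠ n in atTop, ∀ (Coin Msg : Type*) (P : ShuffleProtocol Coin Msg (Fin (universeSize n))),
      P.SendsAtMost 1 → P.IsShuffleDP n (ε n) (privacyDelta C n) →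
        ¬ P.SolvesCountDistinct n (e n) := by
  filter_upwards [hε, he.bound (show (0 : ℝ) < 0.01 by norm_num),
    eventually_mul_nodeCount_pow_le 1600 4,
    eventually_mul_nodeCount_pow_le (⌈768 * Real.exp 5 * C⌉₊ : ℝ) 7,
    tendsto_natCast_atTop_atTop.eventually_ge_atTop (max 1000 (4 * C * Real.exp 1))]
    with n hεn hen hDn hTn hn Coin Msg P hP hDP
  have hn1000 : (1000 : ℝ) ≤ n := (le_max_left _ _).trans hn
  have hnC : 4 * C * Real.exp 1 ≤ n := (le_max_right _ _).trans hn
  have hn0 : 0 < n := by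
    have : (0 : ℝ) < n := by linarith
    exact_mod_cast this
  have hn' : (0 : ℝ) < n := by linarith
  have hκ : 0 < nodeCount n := Nat.succ_pos _
  have hκ' : (0 : ℝ) < nodeCount n := by exact_mod_cast hκ
  have hN : 0 < ⌈768 * Real.exp 5 * C⌉₊ := Nat.ceil_pos.2 (by positivity)
  have hNC : 768 * Real.exp 5 * C ≤ (⌈768 * Real.exp 5 * C⌉₊ : ℝ) := Nat.le_ceil _
  have hT : 0 < testThreshold C n := Nat.mul_pos hN (pow_pos hκ 7)
  have hT' : (0 : ℝ) < testThreshold C n := by exact_mod_cast hT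
  have hTn' : testThreshold C n ≤ n := by
    rw [testThreshold]; exact_mod_cast hTn
  have hTnr : (testThreshold C n : ℝ) ≤ n := by exact_mod_cast hTn'
  have hden : 0 < 16 * nodeCount n ^ 4 := by positivity
  have hD100 : 100 ≤ universeSize n := by
    rw [universeSize, Nat.le_div_iff_mul_le hden]
    have : 1600 * nodeCount n ^ 4 ≤ n := by exact_mod_cast hDn
    omega
  have hDn' : (universeSize n : ℝ) ≤ n := by exact_mod_cast Nat.div_le_self _ _
  -- The divisor `16 * κ ^ 4` is twice the largest node, so `x₀` retains probability at least `1/2`.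
  have hD : universeSize n * node (nodeCount n) ≤ (n : ℝ) / 2 := by
    have h1 : universeSize n * (16 * nodeCount n ^ 4) ≤ n := Nat.div_mul_le_self _ _
    have h2 : (universeSize n : ℝ) * (16 * (nodeCount n : ℝ) ^ 4) ≤ n := by exact_mod_cast h1
    rw [node]
    linarith
  have hδpos : 0 < privacyDelta C n := Real.exp_pos _
  have hδ := privacyDelta_eq C hn0
  have hD8 : ∀ c : ℝ, 0 ≤ c → c * universeSize n * privacyDelta C n ≤
      c * n * ((n : ℝ) ^ (8 * testThreshold C n))⁻¹ := fun c hc => by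
    rw [hδ]
    gcongr
  -- Here the threshold is calibrated: `768 = 4 * 3 * 64` with `node κ ^ 2 = 64 * κ ^ 8`, and `exp
  -- 5` absorbs `exp 1` while leaving `ρ = exp (-4)`.
  have hρ1 : Real.exp 1 * (4 * (2 * C * n / testThreshold C n + 1) *
      node (nodeCount n) ^ 2 / n) ≤ Real.exp (-4) * nodeCount n := by
    have h1 : 2 * C * n / testThreshold C n + 1 ≤ 3 * C * n / testThreshold C n := by
      have : 1 ≤ C * n / testThreshold C n := by
        rw [le_div_iff₀ hT']
        nlinarith
      calc 2 * C * n / testThreshold C n + 1 ≤ 2 * C * n / testThreshold C n +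
            C * n / testThreshold C n := by linarith
        _ = _ := by ring
    have h2 : Real.exp 1 = Real.exp (-4) * Real.exp 5 := by
      rw [← Real.exp_add]; norm_num
    calc _ ≤ Real.exp 1 * (4 * (3 * C * n / testThreshold C n) *
          node (nodeCount n) ^ 2 / n) := by gcongr
      _ = Real.exp (-4) * ((768 * Real.exp 5 * C) * nodeCount n ^ 8 / testThreshold C n) := by
          rw [h2, node]
          field_simp
          ring
      _ ≤ Real.exp (-4) * ((⌈768 * Real.exp 5 * C⌉₊ : ℝ) * nodeCount n ^ 8 /
          testThreshold C n) := by gcongr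
      _ = Real.exp (-4) * nodeCount n := by
          have : (0 : ℝ) < ⌈768 * Real.exp 5 * C⌉₊ := by exact_mod_cast hN
          rw [testThreshold]
          push_cast
          field_simp
  -- As `κ ≥ log n`, `exp (-4) ^ κ ≤ n ^ (-4)`; its square root still beats `D ≤ n`.
  have hsqrt : universeSize n * √(8 * Real.exp (-4) ^ nodeCount n) ≤ 0.01 := by
    have h1 : Real.exp (-4) ^ nodeCount n ≤ ((n : ℝ) ^ 4)⁻¹ := by
      rw [← Real.exp_nat_mul, ← Real.exp_log (inv_pos.2 (pow_pos hn' 4)), Real.exp_le_exp,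
        Real.log_inv, Real.log_pow]
      have := log_le_nodeCount n
      push_cast
      linarith
    have h2 : √(8 * Real.exp (-4) ^ nodeCount n) ≤ 3 / (n : ℝ) ^ 2 := by
      rw [Real.sqrt_le_left (by positivity)]
      calc 8 * Real.exp (-4) ^ nodeCount n ≤ 9 * ((n : ℝ) ^ 4)⁻¹ := by
            have : 0 ≤ ((n : ℝ) ^ 4)⁻¹ := by positivity
            linarith
        _ = (3 / (n : ℝ) ^ 2) ^ 2 := by
            field_simp
            norm_num
    calc universeSize n * √(8 * Real.exp (-4) ^ nodeCount n) ≤ n * (3 / (n : ℝ) ^ 2) := by gcongr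
      _ = 3 / n := by field_simp
      _ ≤ 0.01 := by
          rw [div_le_iff₀ hn']
          norm_num
          linarith
  have hen' : e n ≤ 0.01 * universeSize n := by
    rw [Real.norm_of_nonneg (Nat.cast_nonneg (universeSize n))] at hen
    exact (le_abs_self _).trans hen
  -- The choice `η = 1 / n ^ 2` makes the total approximation error over `n` users `O(1 / n)`.
  have hη0 : (0 : ℝ) < 1 / (n : ℝ) ^ 2 := by positivity
  have hη : (n : ℝ) * (4 * (1 / (n : ℝ) ^ 2)) ≤ 0.01 := by
    have : (n : ℝ) * (4 * (1 / (n : ℝ) ^ 2)) = 4 / n := by field_simp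
    rw [this, div_le_iff₀ hn']
    norm_num
    linarith
  have hδ1 : 4 * (100 * universeSize n * privacyDelta C n) ≤ 1 / (n : ℝ) ^ 2 := by
    calc 4 * (100 * universeSize n * privacyDelta C n)
        = 400 * universeSize n * privacyDelta C n := by ring
      _ ≤ 400 * n * ((n : ℝ) ^ (8 * testThreshold C n))⁻¹ := hD8 400 (by norm_num)
      _ ≤ n * n * ((n : ℝ) ^ 4)⁻¹ := by
          gcongr
          · linarith
          · linarith
          · omega
      _ = 1 / (n : ℝ) ^ 2 := by field_simp
  -- Since `4 * C * exp 1 ≤ n`, the base on the right is at least `n ^ (-4)`. The exponent `8 * T`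
  -- in `δ` covers `4 + 4 * T` because `T ≥ 1`.
  have hδT : 2 * (100 * universeSize n * privacyDelta C n) ≤
      1 / (n : ℝ) ^ 2 * (1 / (n : ℝ) ^ 2 / (4 * C * n * Real.exp 1)) ^ testThreshold C n := by
    calc 2 * (100 * universeSize n * privacyDelta C n)
        = 200 * universeSize n * privacyDelta C n := by ring
      _ ≤ 200 * n * ((n : ℝ) ^ (8 * testThreshold C n))⁻¹ := hD8 200 (by norm_num)
      _ ≤ n * n * ((n : ℝ) ^ (4 + 4 * testThreshold C n))⁻¹ := by
          gcongr
          · linarith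
          · linarith
          · omega
      _ = 1 / (n : ℝ) ^ 2 * (1 / (n : ℝ) ^ 2 / (n * n)) ^ testThreshold C n := by
          have h1 : (1 / (n : ℝ) ^ 2 / (n * n)) = ((n : ℝ) ^ 4)⁻¹ := by field_simp
          rw [h1, inv_pow, ← pow_mul, pow_add]
          field_simp
      _ ≤ _ := by
          refine mul_le_mul_of_nonneg_left (pow_le_pow_left₀ (by positivity)
            (div_le_div_of_nonneg_left (by positivity) (by positivity) ?_) _) (by positivity)
          calc 4 * C * n * Real.exp 1 = (4 * C * Real.exp 1) * n := by ring
            _ ≤ n * n := by gcongr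
  obtain ⟨m, rfl⟩ : ∃ m, n = m + 1 := ⟨n - 1, by omega⟩
  have hcast : ((m + 1 : ℕ) : ℝ) = m + 1 := by push_cast; ring
  rw [hcast] at hη0 hη hδ1 hδT hρ1 hD
  exact not_solvesCountDistinct P hP hδpos hDP hεn hC hT hTn' hη0 hη hδ1 hδT hκ hD hD100 hρ1
    exp_neg_four_le hsqrt hen'

theorem theorem4 (ε : ℕ → ℝ) (hε_nonneg : ∀ n, 0 ≤ ε n)
    (hε : ε =O[atTop] fun _ => (1 : ℝ)) :
    ∃ (δ : ℕ → ℝ) (D : ℕ → ℕ),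
      (∀ n, 0 < δ n ∧ δ n ≤ 1) ∧
      (fun n => -Real.logb 2 (δ n)) =Θ[atTop] (fun n : ℕ => Real.log n ^ 8) ∧
      (fun n => (D n : ℝ)) =Θ[atTop] (fun n : ℕ => (n : ℝ) / Real.log n ^ 4) ∧
      ∀ e : ℕ → ℝ, e =o[atTop] (fun n => (D n : ℝ)) →
        ∀ᶠ n in atTop, ∀ (Coin Msg : Type*) (P : ShuffleProtocol Coin Msg (Fin (D n))),
          P.SendsAtMost 1 → P.IsShuffleDP n (ε n) (δ n) →
            ¬ P.SolvesCountDistinct n (e n) := by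
  obtain ⟨M, hM⟩ := hε.bound
  -- `δ` depends on `ε` only through this constant; the maximum with `0` ensures `C ≥ 1`.
  have hC : 1 ≤ Real.exp (max M 0) := Real.one_le_exp (le_max_right _ _)
  refine ⟨privacyDelta (Real.exp (max M 0)), universeSize, fun n => ⟨Real.exp_pos _, ?_⟩,
    neg_logb_privacyDelta_isTheta (by linarith), universeSize_isTheta, fun e he => ?_⟩
  · refine Real.exp_le_one_iff.2 (neg_nonpos.2 ?_)
    have := Real.log_natCast_nonneg n
    positivity
  · refine eventually_not_solvesCountDistinct hC ?_ he
    filter_upwards [hM] with n hn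
    rw [norm_one, mul_one, Real.norm_of_nonneg (hε_nonneg n)] at hn
    exact Real.exp_le_exp.2 (hn.trans (le_max_left _ _))
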